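/- Notation. Let $c,d,n\ge 1$ be integers and let $G$ be a bipartite graph with parts $L=[n]$ and $R$, which is $(c,d)$-regular: every $v\in L$ has exactly $c$ neighbours in $R$ and every $u\in R$ has exactly $d$ neighbours in $L$. For $\alpha,\delta\in(0,1]$, $G$ is a $(c,d,\alpha,\delta)$-bipartite expander if $|N(S)|\ge\delta c|S|$ for every $S\subseteq L$ with $|S|\le\alpha n$, where $N(S)\subseteq R$ is the set of neighbours of $S$. A $[d,k_0,d_0]$-linear code is a linear subspace $C_0\subseteq\mathbb F_2^d$ of dimension $k_0$ and minimum Hamming distance $d_0$. The Tanner code is $$T(G,C_0)=\{x\in\mathbb F_2^n:\ x_{N(u)}\in C_0\ \text{for every }u\in R\},$$ where $x_{N(u)}=(x_v:v\in N(u))\in\mathbb F_2^d$ (coordinates in increasing order). Theorem. Let $c,d_0$ be positive integers and $\delta\in(0,1]$ with $\delta d_0>3$. There is a constant $\kappa=\kappa(c,\delta,d_0)>0$ such that for all positive integers $d,k_0$, every $\alpha\in(0,1]$ and every $[d,k_0,d_0]$-linear code $C_0$ there are a randomized algorithm (a program for a word RAM with words of $O(\log n)$ bits and fair coin tosses, each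 elementary operation costing one unit of time) and a constant $K$ with the following property. For every $n\ge1$ and every $(c,d,\alpha,\delta)$-bipartite expander $G$ with $|L|=n$, on input the adjacency lists of $G$ and a word $x\in\mathbb F_2^n$: 1. the algorithm halts after at most $Kn$ steps, for every $x$ and every outcome of the coin tosses; 2. if $y\in T(G,C_0)$ differs from $x$ in at most $\alpha n$ coordinates, then the algorithm outputs $y$ with probability at least $1-e^{-\kappa n}$. -/

import Mathlib

/-- A `(c, d)`-regular bipartite graph with left part `L = {0, …, n-1}` (variables) and right part
`R = {0, …, r-1}` (constraints), given by its set of edges. -/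
structure RegularBipartiteGraph (c d n r : ℕ) where
  edges : Finset (Fin n × Fin r)
  left_regular : ∀ v : Fin n, (Finset.univ.filter fun u : Fin r => (v, u) ∈ edges).card = c
  right_regular : ∀ u : Fin r, (Finset.univ.filter fun v : Fin n => (v, u) ∈ edges).card = d

namespace RegularBipartiteGraph

variable {c d n r : ℕ} (G : RegularBipartiteGraph c d n r)

/-- The neighbours in `R` of a variable, listed in increasing order. -/
def nbrOfLeft (v : Fin n) : Fin c ↪o Fin r :=
  Finset.orderEmbOfFin _ (G.left_regular v)

/-- The neighbours in `L` of a constraint, listed in increasing order. -/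
def nbrOfRight (u : Fin r) : Fin d ↪o Fin n :=
  Finset.orderEmbOfFin _ (G.right_regular u)

/-- `N(S) ⊆ R`, the set of neighbours of a set `S ⊆ L` of variables. -/
def neighborhood (S : Finset (Fin n)) : Finset (Fin r) :=
  Finset.univ.filter fun u => ∃ v ∈ S, (v, u) ∈ G.edges

/-- `G` is a `(c, d, α, δ)`-bipartite expander. -/
def IsExpander (α δ : ℝ) : Prop :=
  ∀ S : Finset (Fin n), (S.card : ℝ) ≤ α * n → δ * c * S.card ≤ ((G.neighborhood S).card : ℝ)

/-- The Tanner code `T(G, C₀)`: all words `x` such that, for every constraint `u`, the subword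
`x_{N(u)}` (coordinates in increasing order) is a codeword of `C₀`. -/
def tannerCode (C₀ : Submodule (ZMod 2) (Fin d → ZMod 2)) : Set (Fin n → ZMod 2) :=
  {x | ∀ u : Fin r, (fun j : Fin d => x (G.nbrOfRight u j)) ∈ C₀}

end RegularBipartiteGraph

/-- `C` is a binary `[d, k, d₀]`-linear code: a subspace of `𝔽₂ᵈ` of dimension `k` whose minimum
distance (the least Hamming distance of two distinct codewords) is `d₀`. -/
structure IsLinearCode (d k d₀ : ℕ) (C : Submodule (ZMod 2) (Fin d → ZMod 2)) : Prop where
  dim : Module.finrank (ZMod 2) C = k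
  dist : IsLeast {m : ℕ | ∃ x ∈ C, ∃ y ∈ C, x ≠ y ∧ hammingDist x y = m} d₀

/-! A randomized word RAM. The memory consists of registers and of arrays, both named by numerals
in the program text; an array is indexed by the contents of a register. All cells hold natural
numbers below a modulus `W` (so words of `log₂ W` bits). A program is a fixed finite term, and every
elementary instruction, test and fair coin toss costs one unit of time. -/

namespace RandRAM

/-- Arithmetic and comparison of two words. -/
inductive Op
  | add
  | sub
  | mul
  | lt

/-- The result of an operation, reduced modulo `W`; subtraction is cut off at `0`. -/
def Op.eval (W : ℕ) : Op → ℕ → ℕ → ℕ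
  | .add, a, b => (a + b) % W
  | .sub, a, b => (a - b) % W
  | .mul, a, b => (a * b) % W
  | .lt, a, b => (if a < b then 1 else 0) % W

/-- Programs.
`const i k`: register `i` gets the constant `k`;
`copy i j`: register `i` gets the contents of register `j`;
`op f i j k`: register `i` gets `f` applied to the contents of registers `j` and `k`;
`load i a j`: register `i` gets the entry of array `a` whose index is in register `j`;
`store a j i`: the entry of array `a` whose index is in register `j` gets the contents of
register `i`;
`flip i`: register `i` gets the outcome (0 or 1) of a toss of a fair coin;
`seq p q`: `p`, then `q`;
`cond i p q`: `p` if register `i` is nonzero, and `q` otherwise;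
`loop i p`: repeat `p` as long as register `i` is nonzero. -/
inductive Prog
  | skip
  | const (i k : ℕ)
  | copy (i j : ℕ)
  | op (f : Op) (i j k : ℕ)
  | load (i a j : ℕ)
  | store (a j i : ℕ)
  | flip (i : ℕ)
  | seq (p q : Prog)
  | cond (i : ℕ) (p q : Prog)
  | loop (i : ℕ) (p : Prog)

/-- Contents of the memory. -/
structure Memory where
  reg : ℕ → ℕ
  arr : ℕ → ℕ → ℕ

def Memory.setReg (μ : Memory) (i w : ℕ) : Memory :=
  { μ with reg := Function.update μ.reg i w }

def Memory.setArr (μ : Memory) (a i w : ℕ) : Memory :=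
  { μ with arr := Function.update μ.arr a (Function.update (μ.arr a) i w) }

/-- A configuration: the list of program parts that remain to be executed, and the memory. -/
structure Config where
  todo : List Prog
  mem : Memory

/-- The machine has halted when nothing remains to be executed. -/
def Config.Halted (s : Config) : Prop := s.todo = []

/-- One unit of time. The fair coin `b` of this time unit has an effect only on `flip`. -/
def step (W : ℕ) (b : Bool) : Config → Config
  | ⟨[], μ⟩ => ⟨[], μ⟩
  | ⟨.skip :: K, μ⟩ => ⟨K, μ⟩
  | ⟨.const i k :: K, μ⟩ => ⟨K, μ.setReg i (k % W)⟩
  | ⟨.copy i j :: K, μ⟩ => ⟨K, μ.setReg i (μ.reg j)⟩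
  | ⟨.op f i j k :: K, μ⟩ => ⟨K, μ.setReg i (f.eval W (μ.reg j) (μ.reg k))⟩
  | ⟨.load i a j :: K, μ⟩ => ⟨K, μ.setReg i (μ.arr a (μ.reg j))⟩
  | ⟨.store a j i :: K, μ⟩ => ⟨K, μ.setArr a (μ.reg j) (μ.reg i)⟩
  | ⟨.flip i :: K, μ⟩ => ⟨K, μ.setReg i (b.toNat % W)⟩
  | ⟨.seq p q :: K, μ⟩ => ⟨p :: q :: K, μ⟩
  | ⟨.cond i p q :: K, μ⟩ => if μ.reg i ≠ 0 then ⟨p :: K, μ⟩ else ⟨q :: K, μ⟩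
  | ⟨.loop i p :: K, μ⟩ => if μ.reg i ≠ 0 then ⟨p :: .loop i p :: K, μ⟩ else ⟨K, μ⟩

/-- The configuration after `T` units of time, when the coins are `ω`. -/
def run (W : ℕ) {T : ℕ} (ω : Fin T → Bool) (s : Config) : Config :=
  (List.ofFn ω).foldl (fun s b => step W b s) s

/-- The number of words, when a word has `b` times as many bits as the binary expansion of `n`
(so words of `O(log n)` bits, for constant `b`). -/
def wordModulus (b n : ℕ) : ℕ := 2 ^ (b * Nat.size n)

open Classical in
/-- The probability of an event about `T` independent fair coins. -/
noncomputable def coinProb {T : ℕ} (E : (Fin T → Bool) → Prop) : ℝ :=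
  ((Finset.univ.filter fun ω : Fin T → Bool => E ω).card : ℝ) / 2 ^ T

/-- The input of a decoder: the adjacency lists of `G` and the received word `x`.
Register `0` holds `n = |L|` and register `1` holds `r = |R|`. Entry `v` of array `0` is `x_v`.
For `j < d`, entry `u` of array `1 + j` is the `j`-th neighbour of the constraint `u`.
For `j < c`, entry `v` of array `1 + d + j` is the `j`-th neighbour of the variable `v`.
All other cells are `0`. -/
def inputMemory (W : ℕ) {c d n r : ℕ} (G : RegularBipartiteGraph c d n r) (x : Fin n → ZMod 2) :
    Memory where
  reg i := (if i = 0 then n else if i = 1 then r else 0) % W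
  arr a i :=
    (if a = 0 then
      if h : i < n then (x ⟨i, h⟩).val else 0
    else if ha : a - 1 < d then
      if h : i < r then (G.nbrOfRight ⟨i, h⟩ ⟨a - 1, ha⟩ : ℕ) else 0
    else if ha : a - 1 - d < c then
      if h : i < n then (G.nbrOfLeft ⟨i, h⟩ ⟨a - 1 - d, ha⟩ : ℕ) else 0
    else 0) % W

/-- The machine with program `P` and words of `b * size n` bits, at its start on input `(G, x)`. -/
def start (P : Prog) (b : ℕ) {c d n r : ℕ} (G : RegularBipartiteGraph c d n r)
    (x : Fin n → ZMod 2) : Config :=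
  ⟨[P], inputMemory (wordModulus b n) G x⟩

/-- The machine has halted, and the word that it leaves in array `0` is `y`. -/
def Config.Outputs (s : Config) {n : ℕ} (y : Fin n → ZMod 2) : Prop :=
  s.Halted ∧ ∀ v : Fin n, s.mem.arr 0 v = (y v).val

end RandRAM

/-! Let `t = ⌊1/δ⌋`. Then `δ (t + 1) > 1`, and `δ d₀ > 3` gives `3 t < d₀`. A constraint whose view
differs from some inner codeword in at least one and at most `t` places votes for one of these
places. Let `E` be the set of errors of the current word relative to the codeword `y`, and let a
constraint see `k` of them. For `1 ≤ k ≤ t` its vote goes to an error; for `t < k < d₀ - t` it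
cannot go to a correct variable; for larger `k`, which is at least `2 t + 1`, it may be wrong.
Weighing the cases gives `vote_margin`: `t (A - B) ≥ (t + 1) |N(E)| - c |E|`, where `A` and `B`
count the votes for errors and for correct variables. If `|N(E)| ≥ δ' c |E|` with `δ' (t + 1) > 1`,
then `A - B ≥ 2 h c |E|` for a constant `h > 0`.

Flip every variable independently with probability proportional to its votes. Then `(1 + h) ^ |E|`
shrinks in expectation, by a constant factor for each variable that has votes (`expect_round_le`).
The process can fail only if `|E|` outgrows the range of expansion or if the budget `F n` for the
total length of the candidate lists runs out. Sets of size up to `ν ⌊α n⌋`, with `ν = δ / δ' > 1`,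
still expand by `δ'`, so there is room above the initial number of errors, and a supermartingale
argument bounds both risks (`expect_rounds_le`). A round takes time proportional to its candidate
lists, because a constraint that votes is next to a variable of the preceding list
(`Covers.of_changes`); the total time is linear.

The exponent in the failure bound of one attempt is proportional to `⌊α n⌋`. Repeating `⌈2/α⌉` times
from the same word replaces it by `n`. Successes are recognized because Tanner codewords at distance
at most `3 ⌊α n⌋` coincide (`IsExpander.eq_of_hammingDist_le`); a word that fails the test is
discarded.

The machine is linked to this process by `Impl`: the mean, over the coins, of any nonincreasing
function of the configuration is bounded by an expectation over a coin tree. The indicator of not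
having halted gives the running time, that of not having output `y` the probability. -/

namespace RegularBipartiteGraph

/-! ### Edge counts, errors and votes -/

variable {c d n r : ℕ} (G : RegularBipartiteGraph c d n r)

theorem nbrOfRight_mem (u : Fin r) (j : Fin d) : (G.nbrOfRight u j, u) ∈ G.edges :=
  (Finset.mem_filter.1 (Finset.orderEmbOfFin_mem _ (G.right_regular u) j)).2

theorem exists_nbrOfRight {v : Fin n} {u : Fin r} (h : (v, u) ∈ G.edges) :
    ∃ j, G.nbrOfRight u j = v := by
  have : v ∈ Set.range (G.nbrOfRight u) := by
    rw [nbrOfRight, Finset.range_orderEmbOfFin]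
    simpa using h
  exact this

theorem exists_nbrOfLeft {v : Fin n} {u : Fin r} (h : (v, u) ∈ G.edges) :
    ∃ j, G.nbrOfLeft v j = u := by
  have : u ∈ Set.range (G.nbrOfLeft v) := by
    rw [nbrOfLeft, Finset.range_orderEmbOfFin]
    simpa using h
  exact this

/-- Double counting of the edges that leave a set of variables. -/
theorem sum_card_inter (S : Finset (Fin n)) :
    ∑ u : Fin r, (S.filter fun v => (v, u) ∈ G.edges).card = c * S.card := by
  simp_rw [Finset.card_filter]
  rw [Finset.sum_comm]
  have h : ∀ v ∈ S, ∑ u : Fin r, (if (v, u) ∈ G.edges then 1 else 0) = c := fun v _ => by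
    rw [← Finset.card_filter]
    exact G.left_regular v
  rw [Finset.sum_congr rfl h]
  simp [mul_comm]

theorem card_right_mul (G : RegularBipartiteGraph c d n r) : r * d = c * n := by
  have h := G.sum_card_inter Finset.univ
  simpa [G.right_regular] using h

theorem mem_neighborhood {S : Finset (Fin n)} {u : Fin r} :
    u ∈ G.neighborhood S ↔ ∃ v ∈ S, (v, u) ∈ G.edges := by
  simp [neighborhood]

theorem neighborhood_mono {S T : Finset (Fin n)} (h : S ⊆ T) :
    G.neighborhood S ⊆ G.neighborhood T := by
  intro u hu
  obtain ⟨v, hv, he⟩ := G.mem_neighborhood.1 hu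
  exact G.mem_neighborhood.2 ⟨v, h hv, he⟩

theorem mem_neighborhood_iff_card {S : Finset (Fin n)} {u : Fin r} :
    u ∈ G.neighborhood S ↔ 1 ≤ (S.filter fun v => (v, u) ∈ G.edges).card := by
  rw [mem_neighborhood, Nat.one_le_iff_ne_zero, Finset.card_ne_zero]
  constructor
  · rintro ⟨v, hv, he⟩
    exact ⟨v, by simp [hv, he]⟩
  · rintro ⟨v, hv⟩
    simp only [Finset.mem_filter] at hv
    exact ⟨v, hv⟩

theorem card_neighborhood_le (S : Finset (Fin n)) : (G.neighborhood S).card ≤ c * S.card := by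
  rw [← G.sum_card_inter S, Finset.card_eq_sum_ones, neighborhood, Finset.sum_filter]
  refine Finset.sum_le_sum fun u _ => ?_
  split_ifs with h
  · exact G.mem_neighborhood_iff_card.1 (G.mem_neighborhood.2 h)
  · exact Nat.zero_le _

/-- The subword `z_{N(u)}`. -/
def view (z : Fin n → ZMod 2) (u : Fin r) : Fin d → ZMod 2 := fun j => z (G.nbrOfRight u j)

/-- The variables on which two words differ. -/
def errors {n : ℕ} (y z : Fin n → ZMod 2) : Finset (Fin n) := Finset.univ.filter fun v => z v ≠ y v

@[simp]
theorem mem_errors {y z : Fin n → ZMod 2} {v : Fin n} : v ∈ errors y z ↔ z v ≠ y v := by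
  simp [errors]

theorem card_errors (y z : Fin n → ZMod 2) : (errors y z).card = hammingDist z y := rfl

theorem errors_eq_empty {y z : Fin n → ZMod 2} : errors y z = ∅ ↔ z = y := by
  rw [← Finset.card_eq_zero, card_errors, hammingDist_eq_zero]

theorem hammingDist_view (y z : Fin n → ZMod 2) (u : Fin r) :
    hammingDist (G.view z u) (G.view y u) =
      ((errors y z).filter fun v => (v, u) ∈ G.edges).card := by
  rw [hammingDist, ← Finset.card_map (G.nbrOfRight u).toEmbedding]
  congr 1
  ext v
  simp only [Finset.mem_map, Finset.mem_filter, mem_errors, view]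
  constructor
  · rintro ⟨j, hj, rfl⟩
    exact ⟨(Finset.mem_filter.1 hj).2, G.nbrOfRight_mem u j⟩
  · rintro ⟨hv, he⟩
    obtain ⟨j, rfl⟩ := G.exists_nbrOfRight he
    exact ⟨j, Finset.mem_filter.2 ⟨Finset.mem_univ _, hv⟩, rfl⟩

/-- The variable that constraint `u` wants to flip, when constraints use the inner rule `D`. -/
def vote (D : (Fin d → ZMod 2) → Option (Fin d)) (z : Fin n → ZMod 2) (u : Fin r) :
    Option (Fin n) :=
  (D (G.view z u)).map (G.nbrOfRight u)

/-- The number of constraints that want to flip `v`. -/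
def votes (D : (Fin d → ZMod 2) → Option (Fin d)) (z : Fin n → ZMod 2) (v : Fin n) : ℕ :=
  (Finset.univ.filter fun u => G.vote D z u = some v).card

variable {D : (Fin d → ZMod 2) → Option (Fin d)}

theorem edge_of_vote {z : Fin n → ZMod 2} {u : Fin r} {v : Fin n} (h : G.vote D z u = some v) :
    (v, u) ∈ G.edges := by
  obtain ⟨j, -, rfl⟩ := Option.map_eq_some_iff.1 h
  exact G.nbrOfRight_mem u j

theorem votes_le (z : Fin n → ZMod 2) (v : Fin n) : G.votes D z v ≤ c := by
  refine le_trans (Finset.card_le_card fun u hu => ?_) (G.left_regular v).le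
  simp only [Finset.mem_filter, Finset.mem_univ, true_and] at hu ⊢
  exact G.edge_of_vote hu

/-- The votes for `v` are found among the neighbours of `v`. -/
theorem votes_eq (z : Fin n → ZMod 2) (v : Fin n) :
    G.votes D z v =
      (Finset.univ.filter fun j => G.vote D z (G.nbrOfLeft v j) = some v).card := by
  rw [votes, ← Finset.card_map (G.nbrOfLeft v).toEmbedding]
  congr 1
  ext u
  simp only [Finset.mem_map, Finset.mem_filter, Finset.mem_univ, true_and]
  constructor
  · intro h
    obtain ⟨j, rfl⟩ := G.exists_nbrOfLeft (G.edge_of_vote h)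
    exact ⟨j, h, rfl⟩
  · rintro ⟨j, hj, rfl⟩
    exact hj

/-- A constraint casts at most one vote, so exchanging the sums leaves an indicator for each
constraint. -/
theorem sum_votes (z : Fin n → ZMod 2) (S : Finset (Fin n)) :
    ∑ v ∈ S, (G.votes D z v : ℝ) =
      ∑ u : Fin r, if ∃ v ∈ S, G.vote D z u = some v then (1 : ℝ) else 0 := by
  simp_rw [votes, Finset.card_filter]
  push_cast
  rw [Finset.sum_comm]
  refine Finset.sum_congr rfl fun u _ => ?_
  split_ifs with h
  · obtain ⟨v, hv, hu⟩ := h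
    rw [Finset.sum_eq_single_of_mem v hv]
    · simp [hu]
    · intro w _ hw
      rw [hu, if_neg]
      simpa using hw.symm
  · refine Finset.sum_eq_zero fun v hv => if_neg fun hu => h ⟨v, hv, hu⟩

end RegularBipartiteGraph

/-- A decoding rule for `C` with radius `t`: on words at distance `1, …, t` from a codeword `a` it
points to an error, and it points to a correct position only far away from `a`. -/
structure IsBoundedDecoder {d : ℕ} (C : Submodule (ZMod 2) (Fin d → ZMod 2)) (t d₀ : ℕ)
    (D : (Fin d → ZMod 2) → Option (Fin d)) : Prop where
  points : ∀ w, ∀ a ∈ C, 1 ≤ hammingDist w a → hammingDist w a ≤ t →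
    ∃ j, D w = some j ∧ w j ≠ a j
  far : ∀ w j, D w = some j → ∀ a ∈ C, w j = a j → d₀ ≤ hammingDist w a + t

/-- The rule points to a place where the word differs from a codeword within distance `t`. Balls of
radius `t` around codewords are disjoint, so that codeword is unique; the triangle inequality keeps
any other codeword at distance at least `d₀ - t`. -/
theorem exists_isBoundedDecoder {d t d₀ : ℕ} {C : Submodule (ZMod 2) (Fin d → ZMod 2)}
    (hC : ∀ a ∈ C, ∀ b ∈ C, a ≠ b → d₀ ≤ hammingDist a b) (ht : 2 * t < d₀) :
    ∃ D, IsBoundedDecoder C t d₀ D := by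
  classical
  let P : (Fin d → ZMod 2) → Fin d → Prop := fun w j =>
    ∃ a ∈ C, w j ≠ a j ∧ hammingDist w a ≤ t
  refine ⟨fun w => if h : ∃ j, P w j then some h.choose else none, ?_, ?_⟩
  · intro w a ha h1 h2
    have hne : w ≠ a := fun h => by simp [h] at h1
    obtain ⟨j, hj⟩ := Function.ne_iff.1 hne
    have h : ∃ j, P w j := ⟨j, a, ha, hj, h2⟩
    refine ⟨h.choose, by simp [h], ?_⟩
    obtain ⟨b, hb, hjb, hd⟩ := h.choose_spec
    by_cases hab : a = b
    · rwa [hab]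
    · have h3 := hC a ha b hb hab
      have h4 := hammingDist_triangle a w b
      rw [hammingDist_comm a w] at h4
      omega
  · intro w j hj a ha hja
    by_cases h : ∃ j, P w j
    · simp only [h, dite_true, Option.some.injEq] at hj
      obtain ⟨b, hb, hjb, hd⟩ := h.choose_spec
      rw [hj] at hjb
      have hab : a ≠ b := fun hab => hjb (by rw [hja, hab])
      have h3 := hC a ha b hb hab
      have h4 := hammingDist_triangle a w b
      rw [hammingDist_comm a w] at h4
      omega
    · simp [h] at hj

/-! ### The margin of the votes, and the distance of Tanner codes -/

namespace RegularBipartiteGraph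

variable {c d n r : ℕ} (G : RegularBipartiteGraph c d n r)
  {C : Submodule (ZMod 2) (Fin d → ZMod 2)} {t d₀ : ℕ} {D : (Fin d → ZMod 2) → Option (Fin d)}
  {y z : Fin n → ZMod 2}

/-- A vote at a codeword would point to a correct position at distance `0`, which `far` forbids. -/
theorem vote_eq_none (hD : IsBoundedDecoder C t d₀ D) (ht : t < d₀) {u : Fin r}
    (hy : G.view y u ∈ C) (hu : G.view z u = G.view y u) : G.vote D z u = none := by
  rw [vote, Option.map_eq_none_iff, Option.eq_none_iff_forall_ne_some]
  intro j hj
  have := hD.far _ j hj _ hy (by rw [hu])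
  rw [hu, hammingDist_self] at this
  omega

/-- Votes come only from constraints next to an error. -/
theorem mem_neighborhood_of_vote (hD : IsBoundedDecoder C t d₀ D) (ht : t < d₀) {u : Fin r}
    (hy : G.view y u ∈ C) {v : Fin n} (h : G.vote D z u = some v) :
    u ∈ G.neighborhood (errors y z) := by
  rw [mem_neighborhood_iff_card, ← hammingDist_view]
  by_contra h0
  have h1 : hammingDist (G.view z u) (G.view y u) = 0 := by omega
  rw [G.vote_eq_none hD ht hy (hammingDist_eq_zero.1 h1)] at h
  exact absurd h (by simp)

/-- There are at most as many votes as edges at the errors. -/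
theorem sum_votes_le (hD : IsBoundedDecoder C t d₀ D) (ht : t < d₀) (hy : y ∈ G.tannerCode C) :
    ∑ v, (G.votes D z v : ℝ) ≤ c * (errors y z).card := by
  have h : ((G.neighborhood (errors y z)).card : ℝ) ≤ c * (errors y z).card := by
    exact_mod_cast G.card_neighborhood_le _
  refine le_trans ?_ h
  rw [sum_votes, Finset.card_eq_sum_ones]
  push_cast
  rw [← Finset.sum_filter]
  refine Finset.sum_le_sum_of_subset_of_nonneg (fun u hu => ?_) fun _ _ _ => zero_le_one
  simp only [Finset.mem_filter, Finset.mem_univ, true_and] at hu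
  obtain ⟨v, hv⟩ := hu
  exact G.mem_neighborhood_of_vote hD ht (hy u) hv

/-- Votes for errors outnumber the other votes when the error set expands. -/
theorem vote_margin (hD : IsBoundedDecoder C t d₀ D) (ht : 3 * t < d₀)
    (hy : y ∈ G.tannerCode C) :
    ((t : ℝ) + 1) * (G.neighborhood (errors y z)).card - c * (errors y z).card ≤
      t * (∑ v ∈ errors y z, (G.votes D z v : ℝ) - ∑ v ∈ (errors y z)ᶜ, (G.votes D z v : ℝ)) := by
  have e1 : ((c * (errors y z).card : ℕ) : ℝ) =
      ∑ u : Fin r, (hammingDist (G.view z u) (G.view y u) : ℝ) := by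
    rw [← G.sum_card_inter]
    push_cast
    exact Finset.sum_congr rfl fun u _ => by rw [hammingDist_view]
  have e2 : ((G.neighborhood (errors y z)).card : ℝ) =
      ∑ u : Fin r, if 1 ≤ hammingDist (G.view z u) (G.view y u) then (1 : ℝ) else 0 := by
    rw [← Finset.sum_filter, Finset.card_eq_sum_ones]
    push_cast
    congr 1
    ext u
    simp [mem_neighborhood_iff_card, hammingDist_view]
  push_cast at e1
  rw [e1, e2, sum_votes, sum_votes, ← Finset.sum_sub_distrib, Finset.mul_sum, Finset.mul_sum,
    ← Finset.sum_sub_distrib]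
  refine Finset.sum_le_sum fun u _ => ?_
  generalize hk : hammingDist (G.view z u) (G.view y u) = k
  have hyu : G.view y u ∈ C := hy u
  have htr : (0 : ℝ) ≤ t := Nat.cast_nonneg t
  -- The claim for one constraint is `(t + 1) [k ≥ 1] - k ≤ t (good - bad)`. There is no vote for `k
  -- = 0`, a good one for `1 ≤ k ≤ t`, no bad one for `t < k < d₀ - t`, and at worst a bad one for
  -- `k ≥ d₀ - t`, where `3 t < d₀` gives `k ≥ 2 t + 1`.
  rcases Nat.eq_zero_or_pos k with h0 | h0
  · have hn := G.vote_eq_none hD (by omega) hyu (hammingDist_eq_zero.1 (hk.trans h0))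
    simp [hn, h0]
  have hk1 : (1 : ℝ) ≤ k := by exact_mod_cast h0
  rw [if_pos (show 1 ≤ k from h0)]
  by_cases hkt : k ≤ t
  · obtain ⟨j, hj, hne⟩ := hD.points (G.view z u) _ hyu (by omega) (by omega)
    have hv : G.vote D z u = some (G.nbrOfRight u j) := by simp [vote, hj]
    have hg : ∃ v ∈ errors y z, G.vote D z u = some v :=
      ⟨_, mem_errors.2 hne, hv⟩
    have hb : ¬ ∃ v ∈ (errors y z)ᶜ, G.vote D z u = some v := by
      rintro ⟨v, hv', he⟩
      rw [hv, Option.some.injEq] at he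
      rw [← he, Finset.mem_compl, mem_errors] at hv'
      exact hv' hne
    rw [if_pos hg, if_neg hb]
    linarith
  have hkt' : (t : ℝ) + 1 ≤ k := by exact_mod_cast Nat.lt_of_not_le hkt
  by_cases hkd : k + t < d₀
  · have hb : ¬ ∃ v ∈ (errors y z)ᶜ, G.vote D z u = some v := by
      rintro ⟨v, hv', he⟩
      obtain ⟨j, hj, rfl⟩ := Option.map_eq_some_iff.1 he
      rw [Finset.mem_compl, mem_errors, not_not] at hv'
      have := hD.far _ j hj _ hyu hv'
      omega
    rw [if_neg hb]
    have : (0 : ℝ) ≤ if ∃ v ∈ errors y z, G.vote D z u = some v then 1 else 0 := by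
      split_ifs <;> norm_num
    nlinarith
  · have h2 : 2 * (t : ℝ) + 1 ≤ k := by exact_mod_cast (by omega : 2 * t + 1 ≤ k)
    have h3 : (0 : ℝ) ≤ if ∃ v ∈ errors y z, G.vote D z u = some v then 1 else 0 := by
      split_ifs <;> norm_num
    have h4 : (if ∃ v ∈ (errors y z)ᶜ, G.vote D z u = some v then (1 : ℝ) else 0) ≤ 1 := by
      split_ifs <;> norm_num
    nlinarith

/-- Sets that are slightly too large for the expansion property still expand, slightly less. -/
theorem IsExpander.card_neighborhood_ge {α δ δ' : ℝ} (hG : G.IsExpander α δ) (hα : 0 ≤ α)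
    (hδ' : 0 < δ') (hδδ' : δ' ≤ δ) {S : Finset (Fin n)}
    (hS : (S.card : ℝ) ≤ δ / δ' * ⌊α * n⌋₊) :
    δ' * c * S.card ≤ (G.neighborhood S).card := by
  have hfl : (⌊α * n⌋₊ : ℝ) ≤ α * n := Nat.floor_le (by positivity)
  have hc : (0 : ℝ) ≤ c := Nat.cast_nonneg c
  rcases le_total S.card ⌊α * n⌋₊ with h | h
  · have h' : (S.card : ℝ) ≤ ⌊α * n⌋₊ := by exact_mod_cast h
    refine le_trans ?_ (hG S (h'.trans hfl))
    gcongr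
  -- The neighbours of a subset of size exactly `⌊α n⌋` suffice, since `δ |T| ≥ δ' |S|`.
  · obtain ⟨T, hTS, hT⟩ := Finset.exists_subset_card_eq h
    have h1 := hG T (by rw [hT]; exact hfl)
    have h2 : ((G.neighborhood T).card : ℝ) ≤ (G.neighborhood S).card := by
      exact_mod_cast Finset.card_le_card (G.neighborhood_mono hTS)
    rw [hT] at h1
    refine le_trans ?_ (h1.trans h2)
    have h3 : δ' * (S.card : ℝ) ≤ δ * ⌊α * n⌋₊ := by
      rw [div_mul_eq_mul_div, le_div_iff₀ hδ'] at hS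
      linarith
    nlinarith

/-- Distinct codewords of a Tanner code on an expander are far apart. -/
theorem IsExpander.eq_of_hammingDist_le {α δ : ℝ} (hG : G.IsExpander α δ) (hα : 0 ≤ α)
    (hc : 0 < c) (hm : 1 ≤ ⌊α * n⌋₊) (hC : ∀ a ∈ C, ∀ b ∈ C, a ≠ b → d₀ ≤ hammingDist a b)
    (hδ : 3 < δ * d₀) (hy : y ∈ G.tannerCode C) (hz : z ∈ G.tannerCode C)
    (hyz : hammingDist z y ≤ 3 * ⌊α * n⌋₊) : z = y := by
  by_contra hne
  rw [← card_errors] at hyz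
  set S := errors y z
  have hS : 1 ≤ S.card := by
    rw [Nat.one_le_iff_ne_zero, Ne, Finset.card_eq_zero, errors_eq_empty]
    exact hne
  -- A constraint next to a difference sees two distinct inner codewords, hence at least `d₀`
  -- differences.
  have h1 : d₀ * (G.neighborhood S).card ≤ c * S.card := by
    rw [← G.sum_card_inter S, mul_comm, ← smul_eq_mul, ← Finset.sum_const]
    refine le_trans (Finset.sum_le_sum fun u hu => ?_)
      (Finset.sum_le_sum_of_subset (Finset.subset_univ (G.neighborhood S)))
    rw [← hammingDist_view]
    refine hC (G.view z u) (hz u) _ (hy u) fun h => ?_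
    rw [mem_neighborhood_iff_card, ← hammingDist_view, hammingDist_eq_zero.2 h] at hu
    omega
  have hfl : (⌊α * n⌋₊ : ℝ) ≤ α * n := Nat.floor_le (by positivity)
  have hc' : (0 : ℝ) < c := by exact_mod_cast hc
  -- `T` is small enough to expand, and `|S| ≤ 3 |T|`; its neighbours outnumber `c |S| / d₀` because
  -- `δ d₀ > 3`.
  obtain ⟨T, hTS, hT⟩ := Finset.exists_subset_card_eq (min_le_right ⌊α * n⌋₊ S.card)
  have hT1 : 1 ≤ T.card := by rw [hT]; exact le_min hm hS
  have hTm : T.card ≤ ⌊α * n⌋₊ := by rw [hT]; exact min_le_left _ _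
  have hST : S.card ≤ 3 * T.card := by rw [hT]; rcases min_cases ⌊α * n⌋₊ S.card <;> omega
  have h2 := hG T (le_trans (by exact_mod_cast hTm) hfl)
  have h3 : ((G.neighborhood T).card : ℝ) ≤ (G.neighborhood S).card := by
    exact_mod_cast Finset.card_le_card (G.neighborhood_mono hTS)
  have h1' : (d₀ : ℝ) * (G.neighborhood S).card ≤ c * S.card := by exact_mod_cast h1
  have hST' : (S.card : ℝ) ≤ 3 * T.card := by exact_mod_cast hST
  have hT1' : (0 : ℝ) < T.card := by exact_mod_cast hT1
  have h4 : (d₀ : ℝ) * (δ * c * T.card) ≤ c * (3 * T.card) :=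
    calc (d₀ : ℝ) * (δ * c * T.card) ≤ d₀ * (G.neighborhood S).card := by
          gcongr; exact h2.trans h3
      _ ≤ c * S.card := h1'
      _ ≤ c * (3 * T.card) := by gcongr
  have h5 : 0 < (c : ℝ) * T.card := by positivity
  nlinarith

end RegularBipartiteGraph

/-- Outcomes of a randomized computation, as a finite tree of fair coin tosses. -/
inductive CoinTree (A : Type)
  | leaf (a : A)
  | toss (s t : CoinTree A)

/-! ### Expectations over trees of coin tosses -/

namespace CoinTree

variable {A B : Type}

/-- The expectation of a function of the outcome. -/
noncomputable def expect (g : A → ℝ) : CoinTree A → ℝ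
  | leaf a => g a
  | toss s t => (expect g s + expect g t) / 2

def bind (f : A → CoinTree B) : CoinTree A → CoinTree B
  | leaf a => f a
  | toss s t => toss (bind f s) (bind f t)

/-- All outcomes satisfy `P`. -/
def All (P : A → Prop) : CoinTree A → Prop
  | leaf a => P a
  | toss s t => All P s ∧ All P t

theorem expect_bind (f : A → CoinTree B) (g : B → ℝ) (t : CoinTree A) :
    (t.bind f).expect g = t.expect fun a => (f a).expect g := by
  induction t with
  | leaf a => rfl
  | toss s t hs ht => simp only [bind, expect, hs, ht]

/-- Comparison on possible outcomes only: `Covers` survives a round because all outcomes change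
listed variables alone. -/
theorem expect_le_of_all {P : A → Prop} {g g' : A → ℝ} (h : ∀ a, P a → g a ≤ g' a)
    {t : CoinTree A} (ht : t.All P) : t.expect g ≤ t.expect g' := by
  induction t with
  | leaf a => exact h a ht
  | toss s t hs ht' =>
    have h1 := hs ht.1
    have h2 := ht' ht.2
    simp only [expect]
    linarith

theorem all_true (t : CoinTree A) : t.All fun _ => True := by
  induction t with
  | leaf a => trivial
  | toss s t hs ht => exact ⟨hs, ht⟩

theorem expect_mono {g g' : A → ℝ} (h : ∀ a, g a ≤ g' a) (t : CoinTree A) :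
    t.expect g ≤ t.expect g' :=
  expect_le_of_all (fun a _ => h a) t.all_true

theorem expect_const (b : ℝ) (t : CoinTree A) : (t.expect fun _ => b) = b := by
  induction t with
  | leaf a => rfl
  | toss s t hs ht => simp only [expect, hs, ht]; ring

theorem expect_mul (b : ℝ) (g : A → ℝ) (t : CoinTree A) :
    (t.expect fun a => b * g a) = b * t.expect g := by
  induction t with
  | leaf a => rfl
  | toss s t hs ht => simp only [expect, hs, ht]; ring

theorem All.imp {P Q : A → Prop} (h : ∀ a, P a → Q a) {t : CoinTree A} (ht : t.All P) :
    t.All Q := by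
  induction t with
  | leaf a => exact h a ht
  | toss s t hs ht' => exact ⟨hs ht.1, ht' ht.2⟩

theorem All.bind {P : A → Prop} {Q : B → Prop} {f : A → CoinTree B}
    (h : ∀ a, P a → (f a).All Q) {t : CoinTree A} (ht : t.All P) : (t.bind f).All Q := by
  induction t with
  | leaf a => exact h a ht
  | toss s t hs ht' => exact ⟨hs ht.1, ht' ht.2⟩

/-- `s` coins are appended to the binary expansion of `k`. -/
def uniform : ℕ → ℕ → CoinTree ℕ
  | 0, k => leaf k
  | s + 1, k => toss (uniform s (2 * k + 1)) (uniform s (2 * k))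

theorem expect_uniform (g : ℕ → ℝ) (s k : ℕ) :
    (uniform s k).expect g = (∑ i ∈ Finset.range (2 ^ s), g (2 ^ s * k + i)) / 2 ^ s := by
  induction s generalizing k with
  | zero => simp [uniform, expect]
  | succ s ih =>
    have e : 2 ^ (s + 1) = 2 ^ s + 2 ^ s := by ring
    rw [uniform, expect, ih, ih, e, Finset.sum_range_add]
    have h1 : ∀ i, g (2 ^ s * (2 * k + 1) + i) = g ((2 ^ s + 2 ^ s) * k + (2 ^ s + i)) :=
      fun i => by congr 1; ring
    have h2 : ∀ i, g (2 ^ s * (2 * k) + i) = g ((2 ^ s + 2 ^ s) * k + i) :=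
      fun i => by congr 1; ring
    simp_rw [h1, h2]
    rw [pow_succ]
    field_simp
    ring

/-- The expectation of a function of a biased coin. -/
theorem expect_uniform_lt (s m : ℕ) (hm : m ≤ 2 ^ s) (a b : ℝ) :
    ((uniform s 0).expect fun k => if k < m then a else b) = b + m / 2 ^ s * (a - b) := by
  rw [expect_uniform]
  have h : ∑ i ∈ Finset.range (2 ^ s), (if 2 ^ s * 0 + i < m then a else b) =
      ∑ i ∈ Finset.range (2 ^ s), (b + if i < m then a - b else 0) :=
    Finset.sum_congr rfl fun i _ => by split_ifs <;> simp_all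
  rw [h, Finset.sum_add_distrib, ← Finset.sum_filter]
  have h2 : (Finset.range (2 ^ s)).filter (fun i => i < m) = Finset.range m := by
    ext i
    simp only [Finset.mem_filter, Finset.mem_range]
    omega
  rw [h2]
  simp only [Finset.sum_const, Finset.card_range, nsmul_eq_mul]
  push_cast
  field_simp

end CoinTree

/-! ### The random flipping process -/

namespace RegularBipartiteGraph

open CoinTree

variable {c d n r : ℕ} (G : RegularBipartiteGraph c d n r)
  (D : (Fin d → ZMod 2) → Option (Fin d))

/-- Append the variable of a vote to a list, unless it is there already. -/
def push {n : ℕ} (l : List (Fin n)) : Option (Fin n) → List (Fin n)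
  | none => l
  | some v => if v ∈ l then l else l ++ [v]

/-- Append the votes of the first `k` neighbours of `v`. -/
def collectAt (z : Fin n → ZMod 2) (v : Fin n) (l : List (Fin n)) : ℕ → List (Fin n)
  | 0 => l
  | k + 1 =>
    if h : k < c then push (collectAt z v l k) (G.vote D z (G.nbrOfLeft v ⟨k, h⟩))
    else collectAt z v l k

/-- The list of the variables voted for by the neighbours of the variables in a list. -/
def collect (z : Fin n → ZMod 2) (L : List (Fin n)) : List (Fin n) :=
  L.foldl (fun l v => G.collectAt D z v l c) []

/-- The word `z` with coordinate `v` flipped. -/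
def flipAt {n : ℕ} (z : Fin n → ZMod 2) (v : Fin n) : Fin n → ZMod 2 :=
  Function.update z v (z v + 1)

/-- Every variable `v` of a list is flipped with probability `m v / 2 ^ s`. -/
def flips {n : ℕ} (s : ℕ) (m : Fin n → ℕ) : List (Fin n) → (Fin n → ZMod 2) →
    CoinTree (Fin n → ZMod 2)
  | [], z => leaf z
  | v :: l, z => (uniform s 0).bind fun k => flips s m l (if k < m v then flipAt z v else z)

/-- Rounds of voting and flipping, until there are no votes or the fuel is used up. The first
argument bounds the number of rounds. -/
def rounds : ℕ → ℕ → List (Fin n) → (Fin n → ZMod 2) → CoinTree (Fin n → ZMod 2)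
  | 0, _, _, z => leaf z
  | g + 1, fuel, L, z =>
    if L.length = 0 ∨ fuel = 0 then leaf z
    else (flips c (G.votes D z) (G.collect D z L) z).bind
      (rounds g (fuel - (G.collect D z L).length) (G.collect D z L))

/-- A word `z` found from `w` is accepted if it is in the Tanner code and near `w`. -/
def Accepts (C : Submodule (ZMod 2) (Fin d → ZMod 2)) (p q : ℕ) (w z : Fin n → ZMod 2) : Prop :=
  z ∈ G.tannerCode C ∧ q * hammingDist w z ≤ p * n

open Classical in
/-- One attempt to decode `w`. -/
noncomputable def attempt (C : Submodule (ZMod 2) (Fin d → ZMod 2)) (p q fuel : ℕ)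
    (w : Fin n → ZMod 2) : CoinTree (Fin n → ZMod 2) :=
  (G.rounds D (fuel + 1) fuel (List.finRange n) w).bind fun z =>
    leaf (if G.Accepts C p q w z then z else w)

/-- Repeated attempts. -/
noncomputable def attempts (C : Submodule (ZMod 2) (Fin d → ZMod 2)) (p q fuel : ℕ) : ℕ →
    (Fin n → ZMod 2) → CoinTree (Fin n → ZMod 2)
  | 0, w => leaf w
  | R + 1, w => (G.attempt D C p q fuel w).bind (attempts C p q fuel R)

variable {D}

theorem mem_push {l : List (Fin n)} {o : Option (Fin n)} {v : Fin n} :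
    v ∈ push l o ↔ v ∈ l ∨ o = some v := by
  rcases o with _ | w
  · simp [push]
  · rw [push]
    split_ifs with h
    · constructor
      · exact Or.inl
      · rintro (h' | h')
        · exact h'
        · rwa [← Option.some.inj h']
    · simp [eq_comm]

theorem nodup_push {l : List (Fin n)} {o : Option (Fin n)} (hl : l.Nodup) : (push l o).Nodup := by
  rcases o with _ | w
  · exact hl
  · rw [push]
    split_ifs with h
    · exact hl
    · rw [List.nodup_append]
      refine ⟨hl, List.nodup_singleton w, ?_⟩
      intro a ha b hb hab
      rw [List.mem_singleton] at hb
      exact h (by rwa [← hb, ← hab])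

theorem mem_collectAt {z : Fin n → ZMod 2} {v w : Fin n} {l : List (Fin n)} {k : ℕ} :
    w ∈ G.collectAt D z v l k ↔
      w ∈ l ∨ ∃ j : Fin c, (j : ℕ) < k ∧ G.vote D z (G.nbrOfLeft v j) = some w := by
  induction k with
  | zero => simp [collectAt]
  | succ k ih =>
    rw [collectAt]
    split_ifs with h
    · rw [mem_push, ih, or_assoc]
      refine or_congr_right ⟨?_, ?_⟩
      · rintro (⟨j, hj, hv⟩ | hv)
        · exact ⟨j, by omega, hv⟩
        · exact ⟨⟨k, h⟩, by simp, hv⟩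
      · rintro ⟨j, hj, hv⟩
        rcases Nat.lt_succ_iff_lt_or_eq.1 hj with hj | hj
        · exact Or.inl ⟨j, hj, hv⟩
        · right
          have : j = ⟨k, h⟩ := Fin.ext hj
          rwa [← this]
    · rw [ih]
      refine or_congr_right ⟨?_, ?_⟩
      · rintro ⟨j, hj, hv⟩
        exact ⟨j, by omega, hv⟩
      · rintro ⟨j, hj, hv⟩
        exact ⟨j, by have := j.2; omega, hv⟩

theorem nodup_collectAt {z : Fin n → ZMod 2} {v : Fin n} {l : List (Fin n)} (hl : l.Nodup)
    (k : ℕ) : (G.collectAt D z v l k).Nodup := by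
  induction k with
  | zero => exact hl
  | succ k ih =>
    rw [collectAt]
    split_ifs with h
    · exact nodup_push ih
    · exact ih

theorem collect_append_singleton (z : Fin n → ZMod 2) (L : List (Fin n)) (v : Fin n) :
    G.collect D z (L ++ [v]) = G.collectAt D z v (G.collect D z L) c := by
  simp [collect]

theorem nodup_collect (z : Fin n → ZMod 2) (L : List (Fin n)) : (G.collect D z L).Nodup := by
  induction L using List.reverseRecOn with
  | nil => exact List.nodup_nil
  | append_singleton L v ih =>
    rw [collect_append_singleton]
    exact G.nodup_collectAt ih c

theorem mem_collect {z : Fin n → ZMod 2} {w : Fin n} {L : List (Fin n)} :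
    w ∈ G.collect D z L ↔ ∃ v ∈ L, ∃ j, G.vote D z (G.nbrOfLeft v j) = some w := by
  induction L using List.reverseRecOn with
  | nil => simp [collect]
  | append_singleton L v ih =>
    rw [collect_append_singleton, mem_collectAt, ih]
    simp [or_and_right, exists_or]

theorem length_collect_le (z : Fin n → ZMod 2) (L : List (Fin n)) :
    (G.collect D z L).length ≤ n := by
  simpa using (G.nodup_collect (D := D) z L).length_le_card

/-- Every constraint that votes is next to a variable in the list. -/
def Covers (D : (Fin d → ZMod 2) → Option (Fin d)) (L : List (Fin n)) (z : Fin n → ZMod 2) : Prop :=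
  ∀ u, (G.vote D z u).isSome → ∃ v ∈ L, (v, u) ∈ G.edges

theorem covers_finRange (z : Fin n → ZMod 2) : G.Covers D (List.finRange n) z := by
  intro u hu
  obtain ⟨v, hv⟩ := Option.isSome_iff_exists.1 hu
  exact ⟨v, List.mem_finRange v, G.edge_of_vote hv⟩

/-- Scanning the neighbours of the old list alone misses no vote. -/
theorem Covers.mem_collect_iff {L : List (Fin n)} {z : Fin n → ZMod 2} (h : G.Covers D L z)
    {w : Fin n} : w ∈ G.collect D z L ↔ ∃ u, G.vote D z u = some w := by
  rw [mem_collect]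
  constructor
  · rintro ⟨v, -, j, hj⟩
    exact ⟨_, hj⟩
  · rintro ⟨u, hu⟩
    obtain ⟨v, hv, he⟩ := h u (by simp [hu])
    obtain ⟨j, rfl⟩ := G.exists_nbrOfLeft he
    exact ⟨v, hv, j, hu⟩

/-- A constraint that votes after the flips either contains a changed variable, which is in the new
list, or has its old view and hence its old vote, whose target is in the new list. -/
theorem Covers.of_changes {L : List (Fin n)} {z z' : Fin n → ZMod 2} (h : G.Covers D L z)
    (hz' : ∀ v ∉ G.collect D z L, z' v = z v) : G.Covers D (G.collect D z L) z' := by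
  intro u hu
  by_contra hcon
  push Not at hcon
  have hview : G.view z' u = G.view z u := by
    funext j
    exact hz' _ fun hj => hcon _ hj (G.nbrOfRight_mem u j)
  rw [vote, hview, ← vote] at hu
  obtain ⟨w, hw⟩ := Option.isSome_iff_exists.1 hu
  exact hcon w ((h.mem_collect_iff G).2 ⟨u, hw⟩) (G.edge_of_vote hw)

theorem all_flips (s : ℕ) (m : Fin n → ℕ) (l : List (Fin n)) (z : Fin n → ZMod 2) :
    (flips s m l z).All fun z' => ∀ v ∉ l, z' v = z v := by
  induction l generalizing z with
  | nil => exact fun v _ => rfl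
  | cons w l ih =>
    refine All.bind (P := fun _ => True) (fun k _ => ?_) (all_true _)
    refine (ih (if k < m w then flipAt z w else z)).imp fun z' h v hv => ?_
    rw [List.mem_cons, not_or] at hv
    rw [h v hv.2]
    split_ifs
    · rw [flipAt, Function.update_of_ne hv.1]
    · rfl

theorem add_one_ne_iff (a b : ZMod 2) : a + 1 ≠ b ↔ a = b := by
  revert a b
  decide

theorem errors_flipAt_of_mem {y z : Fin n → ZMod 2} {v : Fin n} (hv : v ∈ errors y z) :
    errors y (flipAt z v) = (errors y z).erase v := by
  ext w
  by_cases hw : w = v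
  · subst hw
    rw [mem_errors] at hv
    have := (add_one_ne_iff (z w) (y w)).not.2 hv
    simpa [flipAt] using this
  · simp [flipAt, hw]

theorem errors_flipAt_of_notMem {y z : Fin n → ZMod 2} {v : Fin n} (hv : v ∉ errors y z) :
    errors y (flipAt z v) = insert v (errors y z) := by
  ext w
  by_cases hw : w = v
  · subst hw
    rw [mem_errors, not_not] at hv
    have := (add_one_ne_iff (z w) (y w)).2 hv
    simpa [flipAt] using this
  · simp [flipAt, hw]

/-- The expected growth of an exponential of the number of errors, when votes lead to independent
flips. -/
theorem expect_flips_le {s : ℕ} {m : Fin n → ℕ} (hm : ∀ v, m v ≤ 2 ^ s) {h : ℝ} (hh : 0 < h)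
    (y : Fin n → ZMod 2) {l : List (Fin n)} (hl : l.Nodup) (z : Fin n → ZMod 2) :
    ((flips s m l z).expect fun z' => (1 + h) ^ (errors y z').card) ≤
      (1 + h) ^ (errors y z).card * Real.exp (h / 2 ^ s *
        (l.map fun v => if v ∈ errors y z then -(m v : ℝ) / (1 + h) else m v).sum) := by
  induction l generalizing z with
  | nil => simp [flips, expect]
  | cons v l ih =>
    obtain ⟨hvl, hl⟩ := List.nodup_cons.1 hl
    set S : ℝ := (l.map fun v => if v ∈ errors y z then -(m v : ℝ) / (1 + h) else m v).sum
    -- The list has no repetitions, so flipping `v` does not affect which later entries are errors.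
    have hS : (l.map fun w => if w ∈ errors y (flipAt z v) then -(m w : ℝ) / (1 + h) else m w).sum
        = S := by
      congr 1
      refine List.map_congr_left fun w hw => ?_
      have hwv : w ≠ v := fun e => hvl (e ▸ hw)
      simp [flipAt, hwv]
    have hE : 0 < Real.exp (h / 2 ^ s * S) := Real.exp_pos _
    have h1h : 0 < 1 + h := by linarith
    have hstep : ((flips s m (v :: l) z).expect fun z' => (1 + h) ^ (errors y z').card) ≤
        (uniform s 0).expect fun k => if k < m v then
          (1 + h) ^ (errors y (flipAt z v)).card * Real.exp (h / 2 ^ s * S)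
          else (1 + h) ^ (errors y z).card * Real.exp (h / 2 ^ s * S) := by
      rw [flips, expect_bind]
      refine expect_mono (fun k => ?_) _
      split_ifs with hk
      · exact (ih hl _).trans_eq (by rw [hS])
      · exact ih hl _
    refine hstep.trans ?_
    rw [expect_uniform_lt s (m v) (hm v), List.map_cons, List.sum_cons, mul_add, Real.exp_add]
    -- A flip multiplies the power by `(1 + h)⁻¹` at an error and by `1 + h` elsewhere. The mean
    -- factor is `1 + x ≤ exp x`, where `x` is the contribution of `v` to the exponent.
    split_ifs with hv
    · rw [errors_flipAt_of_mem hv]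
      have hcard : (errors y z).card = ((errors y z).erase v).card + 1 :=
        (Finset.card_erase_add_one hv).symm
      rw [hcard, pow_succ]
      set b := (1 + h) ^ ((errors y z).erase v).card
      have hb : 0 < b := pow_pos h1h _
      have := Real.add_one_le_exp (h / 2 ^ s * (-(m v : ℝ) / (1 + h)))
      calc _ = (b * (1 + h)) * (h / 2 ^ s * (-(m v : ℝ) / (1 + h)) + 1) *
            Real.exp (h / 2 ^ s * S) := by
            field_simp
            ring
        _ ≤ (b * (1 + h)) * Real.exp (h / 2 ^ s * (-(m v : ℝ) / (1 + h))) *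
            Real.exp (h / 2 ^ s * S) := by gcongr
        _ = _ := by ring
    · rw [errors_flipAt_of_notMem hv, Finset.card_insert_of_notMem hv, pow_succ]
      set b := (1 + h) ^ (errors y z).card
      have hb : 0 < b := pow_pos h1h _
      have := Real.add_one_le_exp (h / 2 ^ s * (m v : ℝ))
      calc _ = b * (h / 2 ^ s * (m v : ℝ) + 1) * Real.exp (h / 2 ^ s * S) := by
            field_simp
            ring
        _ ≤ b * Real.exp (h / 2 ^ s * (m v : ℝ)) * Real.exp (h / 2 ^ s * S) := by gcongr
        _ = _ := by ring

end RegularBipartiteGraph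

/-! ### The failure probability of the process -/

namespace RegularBipartiteGraph

open CoinTree

variable {c d n r : ℕ} (G : RegularBipartiteGraph c d n r)
  {C : Submodule (ZMod 2) (Fin d → ZMod 2)} {t d₀ : ℕ} {D : (Fin d → ZMod 2) → Option (Fin d)}
  {y : Fin n → ZMod 2}

theorem length_collect_le_sum (z : Fin n → ZMod 2) (L : List (Fin n)) :
    ((G.collect D z L).length : ℝ) ≤ ∑ v, (G.votes D z v : ℝ) := by
  rw [← List.toFinset_card_of_nodup (G.nodup_collect z L), Finset.card_eq_sum_ones]
  push_cast
  refine (Finset.sum_le_sum fun v hv => ?_).trans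
    (Finset.sum_le_sum_of_subset_of_nonneg (Finset.subset_univ _) fun _ _ _ => Nat.cast_nonneg _)
  obtain ⟨w, -, j, hj⟩ := G.mem_collect.1 (List.mem_toFinset.1 hv)
  have hpos : 1 ≤ G.votes D z v :=
    Finset.card_pos.2 ⟨_, Finset.mem_filter.2 ⟨Finset.mem_univ _, hj⟩⟩
  exact_mod_cast hpos

/-- One round: an exponential of the number of errors shrinks in expectation. -/
theorem expect_round_le (hD : IsBoundedDecoder C t d₀ D) (ht : t < d₀) (hy : y ∈ G.tannerCode C)
    {h : ℝ} (hh : 0 < h) {L : List (Fin n)} {z : Fin n → ZMod 2} (hL : G.Covers D L z)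
    (hmargin : 2 * h * c * (errors y z).card ≤
      ∑ v ∈ errors y z, (G.votes D z v : ℝ) - ∑ v ∈ (errors y z)ᶜ, (G.votes D z v : ℝ)) :
    ((flips c (G.votes D z) (G.collect D z L) z).expect
      fun z' => (1 + h) ^ (errors y z').card) ≤
      (1 + h) ^ (errors y z).card * Real.exp (-(h ^ 2 / 2 ^ c)) ^ (G.collect D z L).length := by
  refine (expect_flips_le (fun v => (G.votes_le z v).trans Nat.lt_two_pow_self.le) hh y
    (G.nodup_collect z L) z).trans ?_
  rw [← List.sum_toFinset _ (G.nodup_collect z L), ← Real.exp_nat_mul]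
  set A := ∑ v ∈ errors y z, (G.votes D z v : ℝ)
  set B := ∑ v ∈ (errors y z)ᶜ, (G.votes D z v : ℝ)
  have hsum : ∑ v ∈ (G.collect D z L).toFinset,
      (if v ∈ errors y z then -(G.votes D z v : ℝ) / (1 + h) else G.votes D z v) =
        B - A / (1 + h) := by
    rw [Finset.sum_subset (Finset.subset_univ _) fun v _ hv => ?_,
      ← Finset.sum_add_sum_compl (errors y z)]
    · rw [Finset.sum_congr rfl fun v hv => if_pos hv,
        Finset.sum_congr (s₁ := (errors y z)ᶜ) rfl fun v hv => if_neg (Finset.mem_compl.1 hv),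
        ← Finset.sum_div, Finset.sum_neg_distrib]
      ring
    · have h0 : G.votes D z v = 0 := by
        rw [votes, Finset.card_eq_zero, Finset.filter_eq_empty_iff]
        intro u _ hu
        exact hv (List.mem_toFinset.2 ((hL.mem_collect_iff G).2 ⟨u, hu⟩))
      simp [h0]
  rw [hsum]
  have htot : A + B ≤ c * (errors y z).card := by
    have := G.sum_votes_le (z := z) hD ht hy
    rwa [← Finset.sum_add_sum_compl (errors y z)] at this
  have hlen := G.length_collect_le_sum (D := D) z L
  rw [← Finset.sum_add_sum_compl (errors y z)] at hlen
  change _ ≤ A + B at hlen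
  have hA : 0 ≤ A := Finset.sum_nonneg fun _ _ => Nat.cast_nonneg _
  have hB : 0 ≤ B := Finset.sum_nonneg fun _ _ => Nat.cast_nonneg _
  have hdiv : A - h * A ≤ A / (1 + h) := by
    rw [le_div_iff₀ (by linarith)]
    nlinarith [mul_nonneg (mul_nonneg hh.le hh.le) hA]
  -- With `E` the errors, `A / (1 + h) - B ≥ A - B - h A ≥ 2 h c |E| - h c |E| ≥ h (A + B)`, and
  -- each listed variable has a vote.
  have hkey : h * (G.collect D z L).length ≤ A / (1 + h) - B := by nlinarith
  refine mul_le_mul_of_nonneg_left (Real.exp_le_exp.2 ?_) (by positivity)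
  have h2 : (0 : ℝ) < h / 2 ^ c := by positivity
  calc h / 2 ^ c * (B - A / (1 + h)) ≤ h / 2 ^ c * (-(h * (G.collect D z L).length)) := by
        gcongr; linarith
    _ = _ := by ring

open Classical in
/-- The failure probability of the rounds. `Γ` accounts for the risk that the number of errors
grows beyond `β`, where votes may be misleading, and the power of `θ` for the risk that the fuel
is used up. -/
theorem expect_rounds_le (hD : IsBoundedDecoder C t d₀ D) (ht : t < d₀)
    (hy : y ∈ G.tannerCode C) (hc : 0 < c) {h β Γ : ℝ} (hh : 0 < h) (hΓ : 0 ≤ Γ)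
    (hβ : ∀ k : ℕ, β < k → 1 ≤ (1 + h) ^ k * Γ)
    (hmargin : ∀ z, ((errors y z).card : ℝ) ≤ β → 2 * h * c * (errors y z).card ≤
      ∑ v ∈ errors y z, (G.votes D z v : ℝ) - ∑ v ∈ (errors y z)ᶜ, (G.votes D z v : ℝ))
    (g fuel : ℕ) (hg : fuel < g) (L : List (Fin n)) (z : Fin n → ZMod 2) (hL : G.Covers D L z) :
    ((G.rounds D g fuel L z).expect fun z' => if z' = y then 0 else 1) ≤
      (1 + h) ^ (errors y z).card * (Γ + Real.exp (-(h ^ 2 / 2 ^ c)) ^ fuel) := by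
  set θ := Real.exp (-(h ^ 2 / 2 ^ c)) with hθ
  have hθ0 : 0 < θ := Real.exp_pos _
  have hθ1 : θ ≤ 1 := Real.exp_le_one_iff.2 (by simp only [Left.neg_nonpos_iff]; positivity)
  induction g generalizing fuel L z with
  | zero => omega
  | succ g ih =>
    have hpow : (1 : ℝ) ≤ (1 + h) ^ (errors y z).card := one_le_pow₀ (by linarith)
    have htriv : ∀ t' : CoinTree (Fin n → ZMod 2),
        (t'.expect fun z' => if z' = y then (0 : ℝ) else 1) ≤ 1 := fun t' => by
      refine (expect_mono (fun a => ?_) t').trans_eq (expect_const 1 t')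
      split_ifs <;> norm_num
    -- Beyond `β` the margin is unknown, but the term with `Γ` alone makes the bound at least `1`.
    by_cases hbig : β < (errors y z).card
    · refine (htriv _).trans ((hβ _ hbig).trans ?_)
      gcongr
      exact le_add_of_nonneg_right (by positivity)
    have hmz := hmargin z (not_lt.1 hbig)
    -- Without votes the margin forces the error set to be empty.
    have hzero : (∀ u v, G.vote D z u ≠ some v) → z = y := by
      intro hno
      have h0 : ∀ v, G.votes D z v = 0 := by
        intro v
        rw [votes, Finset.card_eq_zero, Finset.filter_eq_empty_iff]
        exact fun u _ => hno u v
      simp only [h0, Nat.cast_zero, Finset.sum_const_zero, sub_zero] at hmz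
      have hc' : (0 : ℝ) < c := by exact_mod_cast hc
      have h1 : ((errors y z).card : ℝ) ≤ 0 := by
        by_contra hcon
        push Not at hcon
        have : 0 < 2 * h * c * (errors y z).card := by positivity
        linarith
      have h2 : (errors y z).card = 0 := by exact_mod_cast le_antisymm h1 (by positivity)
      exact errors_eq_empty.1 (Finset.card_eq_zero.1 h2)
    rw [rounds]
    split_ifs with hend
    · rw [expect]
      rcases hend with hlen | hf
      · have hz : z = y := by
          refine hzero fun u w hu => ?_
          obtain ⟨v, hv, -⟩ := hL u (by simp [hu])
          rw [List.length_eq_zero_iff.1 hlen] at hv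
          simp at hv
        rw [if_pos hz]
        positivity
      · rw [hf, pow_zero]
        split_ifs
        · positivity
        · nlinarith
    · push Not at hend
      rw [expect_bind]
      set N := G.collect D z L
      rcases Nat.eq_zero_or_pos N.length with hN | hN
      · have hnil : N = [] := List.length_eq_zero_iff.1 hN
        have hz : z = y := by
          refine hzero fun u w hu => ?_
          have hw : w ∈ N := (hL.mem_collect_iff G).2 ⟨u, hu⟩
          rw [hnil] at hw
          simp at hw
        rw [hnil, flips, expect]
        rcases g with _ | g
        · rw [rounds, expect, if_pos hz]; positivity
        · rw [rounds, if_pos (by simp), expect, if_pos hz]; positivity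
      -- A nonempty list spends fuel, so `fuel < g` persists. The gain `θ ^ N.length` of the round
      -- compensates for the fuel spent; truncation of the subtraction only helps.
      · calc _ ≤ (flips c (G.votes D z) N z).expect fun z' =>
              (Γ + θ ^ (fuel - N.length)) * (1 + h) ^ (errors y z').card := by
              refine expect_le_of_all (fun z' hz' => ?_) (all_flips c _ N z)
              rw [mul_comm]
              exact ih _ (by omega) N z' (hL.of_changes G hz')
          _ ≤ (Γ + θ ^ (fuel - N.length)) * ((1 + h) ^ (errors y z).card * θ ^ N.length) := by
              rw [expect_mul]
              exact mul_le_mul_of_nonneg_left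
                (G.expect_round_le hD ht hy hh hL hmz) (by positivity)
          _ = (1 + h) ^ (errors y z).card *
              (Γ * θ ^ N.length + θ ^ (fuel - N.length + N.length)) := by ring
          _ ≤ _ := by
              refine mul_le_mul_of_nonneg_left (add_le_add ?_ ?_) (by positivity)
              · exact mul_le_of_le_one_right hΓ (pow_le_one₀ hθ0.le hθ1)
              · exact pow_le_pow_of_le_one hθ0.le hθ1 (by omega)

/-- No constraint votes at a codeword. This is why later attempts do not spoil a success. -/
theorem rounds_of_mem_tannerCode (hD : IsBoundedDecoder C t d₀ D) (ht : t < d₀)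
    (hy : y ∈ G.tannerCode C) (g fuel : ℕ) (L : List (Fin n)) :
    G.rounds D g fuel L y = leaf y := by
  have hcol : G.collect D y L = [] := by
    refine List.eq_nil_iff_forall_not_mem.2 fun w hw => ?_
    obtain ⟨v, -, j, hj⟩ := G.mem_collect.1 hw
    rw [G.vote_eq_none hD ht (hy _) rfl] at hj
    exact absurd hj (by simp)
  rcases g with _ | g
  · rfl
  · rw [rounds, hcol, flips, CoinTree.bind]
    split_ifs
    · rfl
    · rcases g with _ | g <;> simp [rounds]

theorem attempt_of_mem_tannerCode (hD : IsBoundedDecoder C t d₀ D) (ht : t < d₀)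
    (hy : y ∈ G.tannerCode C) (p q fuel : ℕ) : G.attempt D C p q fuel y = leaf y := by
  rw [attempt, G.rounds_of_mem_tannerCode hD ht hy, CoinTree.bind]
  simp

theorem attempts_of_mem_tannerCode (hD : IsBoundedDecoder C t d₀ D) (ht : t < d₀)
    (hy : y ∈ G.tannerCode C) (p q fuel R : ℕ) : G.attempts D C p q fuel R y = leaf y := by
  induction R with
  | zero => rfl
  | succ R ih => rw [attempts, G.attempt_of_mem_tannerCode hD ht hy, CoinTree.bind, ih]

open Classical in
/-- Repeated attempts succeed unless all of them fail. -/
theorem expect_attempts_le (hD : IsBoundedDecoder C t d₀ D) (ht : t < d₀)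
    (hy : y ∈ G.tannerCode C) {p q fuel : ℕ} {x : Fin n → ZMod 2} {ρ : ℝ} (hρ : 0 ≤ ρ)
    (hacc : ∀ z, G.Accepts C p q x z → z = y) (hyx : G.Accepts C p q x y)
    (hround : ((G.rounds D (fuel + 1) fuel (List.finRange n) x).expect
      fun z' => if z' = y then 0 else 1) ≤ ρ) (R : ℕ) :
    ((G.attempts D C p q fuel R x).expect fun z' => if z' = y then 0 else 1) ≤ ρ ^ R := by
  induction R with
  | zero =>
    rw [attempts, expect, pow_zero]
    split_ifs <;> norm_num
  | succ R ih =>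
    rw [attempts, expect_bind, attempt, expect_bind]
    calc _ ≤ (G.rounds D (fuel + 1) fuel (List.finRange n) x).expect fun z =>
          ρ ^ R * if z = y then 0 else 1 := by
          refine expect_mono (fun z => ?_) _
          rw [expect]
          -- Only `y` is accepted, so a failed attempt restores `x` and the next one is a fresh
          -- trial.
          by_cases hz : z = y
          · rw [if_pos hz, hz, if_pos hyx, G.attempts_of_mem_tannerCode hD ht hy, expect]
            simp
          · rw [if_neg hz, if_neg fun ha => hz (hacc z ha), mul_one]
            exact ih
      _ ≤ ρ ^ R * ρ := by
          rw [expect_mul]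
          exact mul_le_mul_of_nonneg_left hround (by positivity)
      _ = _ := (pow_succ _ _).symm

end RegularBipartiteGraph

/-! ### Means over machine runs, and a calculus of programs -/

namespace RandRAM

/-- The mean of `f` over the configurations after `T` units of time. -/
noncomputable def avg (W : ℕ) (f : Config → ℝ) : ℕ → Config → ℝ
  | 0, s => f s
  | T + 1, s => (avg W f T (step W true s) + avg W f T (step W false s)) / 2

theorem run_cons (W : ℕ) {T : ℕ} (b : Bool) (ω : Fin T → Bool) (s : Config) :
    run W (Fin.cons b ω : Fin (T + 1) → Bool) s = run W ω (step W b s) := by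
  simp [run, List.ofFn_succ]

open Classical in
theorem avg_eq_sum (W : ℕ) (f : Config → ℝ) (T : ℕ) (s : Config) :
    avg W f T s = (∑ ω : Fin T → Bool, f (run W ω s)) / 2 ^ T := by
  induction T generalizing s with
  | zero => simp [avg, run]
  | succ T ih =>
    rw [avg, ih, ih, ← (Fin.consEquiv fun _ => Bool).sum_comp, Fintype.sum_prod_type,
      Fintype.sum_bool]
    simp only [Fin.consEquiv, Equiv.coe_fn_mk, run_cons, pow_succ]
    field_simp

-- Failure indicators are used because they are absorbing, so that `Impl` applies to them.
open Classical in
theorem coinProb_eq_avg (W T : ℕ) (E : Config → Prop) (s : Config) :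
    (coinProb fun ω : Fin T → Bool => E (run W ω s)) =
      1 - avg W (fun s => if E s then 0 else 1) T s := by
  have h : (∑ ω : Fin T → Bool, if E (run W ω s) then (0 : ℝ) else 1) =
      2 ^ T - ((Finset.univ.filter fun ω : Fin T → Bool => E (run W ω s)).card : ℝ) := by
    have h1 : ∀ ω : Fin T → Bool, (if E (run W ω s) then (0 : ℝ) else 1) =
        1 - if E (run W ω s) then 1 else 0 := fun ω => by split_ifs <;> norm_num
    rw [Finset.sum_congr rfl fun ω _ => h1 ω, Finset.sum_sub_distrib, Finset.sum_boole]
    simp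
  rw [avg_eq_sum, h, coinProb]
  field_simp
  ring

/-- `f` does not grow along the computation. -/
def Absorbing (W : ℕ) (f : Config → ℝ) : Prop := ∀ s b, f (step W b s) ≤ f s

theorem avg_succ_le {W : ℕ} {f : Config → ℝ} (hf : Absorbing W f) (T : ℕ) (s : Config) :
    avg W f (T + 1) s ≤ avg W f T s := by
  induction T generalizing s with
  | zero =>
    have h1 := hf s true
    have h2 := hf s false
    simp only [avg]
    linarith
  | succ T ih =>
    have h1 := ih (step W true s)
    have h2 := ih (step W false s)
    change (avg W f (T + 1) _ + avg W f (T + 1) _) / 2 ≤ (avg W f T _ + avg W f T _) / 2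
    linarith

/-- Surplus time does no harm, so upper bounds on running times are enough throughout. -/
theorem avg_antitone {W : ℕ} {f : Config → ℝ} (hf : Absorbing W f) (s : Config) :
    Antitone fun T => avg W f T s :=
  antitone_nat_of_succ_le fun T => avg_succ_le hf T s

theorem avg_succ_of_step {W : ℕ} {f : Config → ℝ} {s s' : Config}
    (h : ∀ b, step W b s = s') (T : ℕ) : avg W f (T + 1) s = avg W f T s' := by
  rw [avg, h, h]
  ring

theorem absorbing_indicator {W : ℕ} (E : Config → Prop) [DecidablePred E]
    (hE : ∀ s b, E s → E (step W b s)) :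
    Absorbing W fun s => if E s then 0 else 1 := by
  intro s b
  by_cases h : E s
  · simp [h, hE s b h]
  · simp only [h, if_false]
    split_ifs <;> norm_num

/-- From memory `μ`, the program `p` ends within `k` units of time, and its random outcome is
described by the coin tree `t`: an outcome `a` of `t` stands for a final memory related to `a`. -/
def Impl (W : ℕ) (p : Prog) (μ : Memory) (k : ℕ) {A : Type} (t : CoinTree A)
    (Q : A → Memory → Prop) : Prop :=
  ∀ f, Absorbing W f → ∀ (K : List Prog) (T : ℕ) (g : A → ℝ),
    (∀ a μ', Q a μ' → avg W f T ⟨K, μ'⟩ ≤ g a) → avg W f (T + k) ⟨p :: K, μ⟩ ≤ t.expect g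

/-- From memory `μ`, the program `p` ends within `k` units of time in a memory with `Q`. -/
def Ends (W : ℕ) (p : Prog) (μ : Memory) (k : ℕ) (Q : Memory → Prop) : Prop :=
  Impl W p μ k (CoinTree.leaf ()) fun _ => Q

variable {W k k₁ k₂ : ℕ} {p q : Prog} {μ : Memory} {A B : Type} {t : CoinTree A}

theorem Impl.weaken {Q Q' : A → Memory → Prop} (h : Impl W p μ k₁ t Q)
    (hQ : ∀ a μ', Q a μ' → Q' a μ') (hk : k₁ ≤ k₂) : Impl W p μ k₂ t Q' :=
  fun f hf K T g hg => (avg_antitone hf _ (by omega : T + k₁ ≤ T + k₂)).trans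
    (h f hf K T g fun a μ' hq => hg a μ' (hQ a μ' hq))

theorem Ends.weaken {Q Q' : Memory → Prop} (h : Ends W p μ k₁ Q)
    (hQ : ∀ μ', Q μ' → Q' μ') (hk : k₁ ≤ k₂) : Ends W p μ k₂ Q' :=
  Impl.weaken h (fun _ => hQ) hk

/-- Outcomes may be renamed. -/
theorem Impl.map {Q : A → Memory → Prop} {Q' : B → Memory → Prop} (h : Impl W p μ k t Q)
    (f : A → B) (hQ : ∀ a μ', Q a μ' → Q' (f a) μ') :
    Impl W p μ k (t.bind fun a => CoinTree.leaf (f a)) Q' := by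
  intro φ hφ K T g hg
  rw [CoinTree.expect_bind]
  exact h φ hφ K T _ fun a μ' hq => hg _ _ (hQ a μ' hq)

/-- The bound that `q` guarantees after an outcome of `p` serves as the function `g` for `p`; this
is possible because `Impl` quantifies over all continuations `K`. -/
theorem Impl.seq {Q : A → Memory → Prop} {Q' : B → Memory → Prop} {t' : A → CoinTree B}
    (hp : Impl W p μ k₁ t Q) (hq : ∀ a μ', Q a μ' → Impl W q μ' k₂ (t' a) Q') :
    Impl W (.seq p q) μ (k₁ + k₂ + 1) (t.bind t') Q' := by
  intro f hf K T g hg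
  rw [CoinTree.expect_bind, ← add_assoc, avg_succ_of_step fun b => rfl,
    show T + (k₁ + k₂) = T + k₂ + k₁ by ring]
  exact hp f hf (q :: K) (T + k₂) _ fun a μ' h => hq a μ' h f hf K T g hg

theorem Ends.seq {Q : Memory → Prop} {Q' : A → Memory → Prop}
    (hp : Ends W p μ k₁ Q) (hq : ∀ μ', Q μ' → Impl W q μ' k₂ t Q') :
    Impl W (.seq p q) μ (k₁ + k₂ + 1) t Q' :=
  Impl.seq (t' := fun _ => t) hp fun _ => hq

/-- A random part followed by a part without randomness. -/
theorem Impl.seq_ends {Q Q' : A → Memory → Prop}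
    (hp : Impl W p μ k₁ t Q) (hq : ∀ a μ', Q a μ' → Ends W q μ' k₂ (Q' a)) :
    Impl W (.seq p q) μ (k₁ + k₂ + 1) t Q' := by
  intro f hf K T g hg
  rw [← add_assoc, avg_succ_of_step fun b => rfl, show T + (k₁ + k₂) = T + k₂ + k₁ by ring]
  exact hp f hf (q :: K) (T + k₂) _ fun a μ' h => hq a μ' h f hf K T _ fun _ μ'' => hg a μ''

theorem Impl.loop_zero {i : ℕ} (hi : μ.reg i = 0) {Q : A → Memory → Prop} {a : A} (hQ : Q a μ) :
    Impl W (.loop i p) μ 1 (CoinTree.leaf a) Q := by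
  intro f hf K T g hg
  rw [avg_succ_of_step (s' := ⟨K, μ⟩) fun b => by simp [step, hi]]
  exact hg a μ hQ

theorem Impl.loop_ne_zero {i : ℕ} (hi : μ.reg i ≠ 0) {Q : A → Memory → Prop}
    {Q' : B → Memory → Prop} {t' : A → CoinTree B}
    (hp : Impl W p μ k₁ t Q) (hq : ∀ a μ', Q a μ' → Impl W (.loop i p) μ' k₂ (t' a) Q') :
    Impl W (.loop i p) μ (k₁ + k₂ + 1) (t.bind t') Q' := by
  intro f hf K T g hg
  rw [CoinTree.expect_bind, ← add_assoc,
    avg_succ_of_step (s' := ⟨p :: .loop i p :: K, μ⟩) fun b => by simp [step, hi],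
    show T + (k₁ + k₂) = T + k₂ + k₁ by ring]
  exact hp f hf _ (T + k₂) _ fun a μ' h => hq a μ' h f hf K T g hg

theorem Impl.flip {i : ℕ} {Q : Bool → Memory → Prop}
    (h : ∀ b : Bool, Q b (μ.setReg i (b.toNat % W))) :
    Impl W (.flip i) μ 1 (.toss (.leaf true) (.leaf false)) Q := by
  intro f hf K T g hg
  rw [avg]
  simp only [step, CoinTree.expect]
  have h1 := hg _ _ (h true)
  have h2 := hg _ _ (h false)
  linarith

/-- Programs without coin tosses and loops. -/
def Prog.Straight : Prog → Prop
  | .flip _ => False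
  | .loop _ _ => False
  | .seq p q => p.Straight ∧ q.Straight
  | .cond _ p q => p.Straight ∧ q.Straight
  | _ => True

def Prog.size : Prog → ℕ
  | .seq p q => p.size + q.size + 1
  | .cond _ p q => p.size + q.size + 1
  | .loop _ p => p.size + 1
  | _ => 1

/-- The memory after a straight program. -/
def Prog.exec (W : ℕ) : Prog → Memory → Memory
  | .const i k, μ => μ.setReg i (k % W)
  | .copy i j, μ => μ.setReg i (μ.reg j)
  | .op f i j k, μ => μ.setReg i (f.eval W (μ.reg j) (μ.reg k))
  | .load i a j, μ => μ.setReg i (μ.arr a (μ.reg j))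
  | .store a j i, μ => μ.setArr a (μ.reg j) (μ.reg i)
  | .seq p q, μ => q.exec W (p.exec W μ)
  | .cond i p q, μ => if μ.reg i ≠ 0 then p.exec W μ else q.exec W μ
  | _, μ => μ

/-- The size counts both branches of a conditional; absorption discards the time that the chosen
branch does not need. -/
theorem avg_straight {f : Config → ℝ} (hf : Absorbing W f) (hp : p.Straight) (K : List Prog)
    (T : ℕ) (μ : Memory) : avg W f (T + p.size) ⟨p :: K, μ⟩ ≤ avg W f T ⟨K, p.exec W μ⟩ := by
  induction p generalizing K T μ with
  | flip _ => exact hp.elim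
  | loop _ _ => exact hp.elim
  | seq p q ihp ihq =>
    rw [Prog.size, ← add_assoc, avg_succ_of_step fun b => rfl,
      show T + (p.size + q.size) = T + q.size + p.size by ring]
    exact (ihp hp.1 _ _ _).trans (ihq hp.2 _ _ _)
  | cond i p q ihp ihq =>
    rw [Prog.size, ← add_assoc, Prog.exec]
    by_cases h : μ.reg i ≠ 0
    · rw [if_pos h, avg_succ_of_step (s' := ⟨p :: K, μ⟩) fun b => by simp [step, h]]
      exact (avg_antitone hf _ (by omega : T + p.size ≤ T + (p.size + q.size))).trans (ihp hp.1 _ _ _)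
    · rw [if_neg h, avg_succ_of_step (s' := ⟨q :: K, μ⟩) fun b => by simp [step, h]]
      exact (avg_antitone hf _ (by omega : T + q.size ≤ T + (p.size + q.size))).trans (ihq hp.2 _ _ _)
  | _ => exact (avg_succ_of_step (fun b => rfl) T).le

theorem Impl.straight (hp : p.Straight) {Q : A → Memory → Prop} {a : A} (h : Q a (p.exec W μ)) :
    Impl W p μ p.size (.leaf a) Q :=
  fun _ hf K T _ hg => (avg_straight hf hp K T μ).trans (hg a _ h)

theorem Ends.straight (hp : p.Straight) {Q : Memory → Prop} (h : Q (p.exec W μ)) :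
    Ends W p μ p.size Q :=
  Impl.straight hp h

@[simp] theorem setReg_arr (μ : Memory) (i w : ℕ) : (μ.setReg i w).arr = μ.arr := rfl
@[simp] theorem setArr_reg (μ : Memory) (a i w : ℕ) : (μ.setArr a i w).reg = μ.reg := rfl

@[simp] theorem setReg_reg (μ : Memory) (i w j : ℕ) :
    (μ.setReg i w).reg j = if j = i then w else μ.reg j := by
  simp [Memory.setReg, Function.update_apply]

theorem setArr_arr (μ : Memory) (a i w a' i' : ℕ) :
    (μ.setArr a i w).arr a' i' = if a' = a ∧ i' = i then w else μ.arr a' i' := by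
  simp only [Memory.setArr, Function.update_apply]
  split_ifs <;> simp_all

/-- The results of the steps `i, …, i + m - 1`, one after the other. -/
def iter (g : ℕ → A → CoinTree A) : ℕ → ℕ → A → CoinTree A
  | _, 0, a => .leaf a
  | i, m + 1, a => (g i a).bind (iter g (i + 1) m)

/-- Repeat `body` with register `3` running through the numbers below the contents of register `N`;
register `2` must contain `1`. -/
def forLoop (N : ℕ) (body : Prog) : Prog :=
  .seq (.const 3 0) (.seq (.op .lt 4 3 N)
    (.loop 4 (.seq body (.seq (.op .add 3 3 2) (.op .lt 4 3 N)))))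

/-- The properties of memory that `I` expresses do not concern the registers `3` and `4`. -/
def LoopStable (I : Memory → Prop) : Prop := ∀ μ i w, i = 3 ∨ i = 4 → I μ → I (μ.setReg i w)

/-- Registers `3` and `4` hold the counter and the loop test. A pass costs `5` more than its body:
three units for increment and comparison, one for sequencing, one for the test. `M < W` keeps the
counter from wrapping around. -/
theorem Impl.forLoop {N M : ℕ} (hM : M < W) (h1 : 1 < W) {body : Prog}
    {I : ℕ → A → Memory → Prop} {g : ℕ → A → CoinTree A} (hN : N ≠ 3 ∧ N ≠ 4)
    (hI : ∀ i a μ, I i a μ → μ.reg 2 = 1 ∧ μ.reg N = M)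
    (hst : ∀ i a, LoopStable (I i a))
    (hbody : ∀ i < M, ∀ a μ, I i a μ → μ.reg 3 = i →
      Impl W body μ k (g i a) fun a' μ' => I (i + 1) a' μ' ∧ μ'.reg 3 = i)
    {a : A} (hμ : I 0 a μ) :
    Impl W (RandRAM.forLoop N body) μ (M * (k + 5) + 5) (iter g 0 M a) (I M) := by
  have key : ∀ m i a μ, i + m = M → I i a μ → μ.reg 3 = i → μ.reg 4 = (if i < M then 1 else 0) →
      Impl W (.loop 4 (.seq body (.seq (.op .add 3 3 2) (.op .lt 4 3 N)))) μ (m * (k + 5) + 1)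
        (iter g i m a) (I M) := by
    intro m
    induction m with
    | zero =>
      intro i a μ hi ha h3 h4
      rw [if_neg (by omega)] at h4
      obtain rfl : i = M := by omega
      exact (Impl.loop_zero h4 ha).weaken (fun _ _ h => h) (by omega)
    | succ m ih =>
      intro i a μ hi ha h3 h4
      rw [if_pos (by omega)] at h4
      have hloop := Impl.loop_ne_zero (W := W) (i := 4) (by omega)
        (Impl.seq_ends (hbody i (by omega) a μ ha h3)
          (q := .seq (.op .add 3 3 2) (.op .lt 4 3 N)) (k₂ := 3)
          (Q' := fun a' μ' => I (i + 1) a' μ' ∧ μ'.reg 3 = i + 1 ∧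
            μ'.reg 4 = if i + 1 < M then 1 else 0)
          fun a' μ' h => ?_) (t' := iter g (i + 1) m) (Q' := I M) (k₂ := m * (k + 5) + 1)
          (fun a' μ' h => ih (i + 1) a' μ' (by omega) h.1 h.2.1 h.2.2)
      · exact hloop.weaken (fun _ _ h => h) (le_of_eq (by ring))
      · obtain ⟨h2, hN'⟩ := hI _ _ _ h.1
        refine Ends.straight (p := .seq (.op .add 3 3 2) (.op .lt 4 3 N)) ⟨trivial, trivial⟩ ?_
        have e1 : (i + 1) % W = i + 1 := Nat.mod_eq_of_lt (by omega)
        have e2 : (if i + 1 < M then 1 else 0) % W = if i + 1 < M then 1 else 0 :=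
          Nat.mod_eq_of_lt (by split_ifs <;> omega)
        simp only [Prog.exec, Op.eval, h2, h.2, e1]
        refine ⟨hst _ _ _ _ _ (Or.inr rfl) (hst _ _ _ _ _ (Or.inl rfl) h.1), by simp, ?_⟩
        simp [hN.1, hN', e2]
  have hstart := Ends.seq (W := W) (μ := μ)
    (Ends.straight (W := W) (μ := μ) (p := .const 3 0) trivial
      (Q := fun μ' => I 0 a μ' ∧ μ'.reg 3 = 0)
      ⟨hst _ _ _ _ _ (Or.inl rfl) hμ, by simp [Prog.exec]⟩)
    (fun μ' h => Ends.seq (W := W)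
      (Ends.straight (W := W) (μ := μ') (p := .op .lt 4 3 N) trivial
        (Q := fun μ' => I 0 a μ' ∧ μ'.reg 3 = 0 ∧ μ'.reg 4 = if 0 < M then 1 else 0)
        ?_) fun μ'' h' => key M 0 a μ'' (by omega) h'.1 h'.2.1 h'.2.2)
  · exact hstart.weaken (fun _ _ h => h) (by simp only [Prog.size]; omega)
  · obtain ⟨h2, hN'⟩ := hI _ _ _ h.1
    refine ⟨hst _ _ _ _ _ (Or.inr rfl) h.1, by simp [Prog.exec, h.2], ?_⟩
    have e2 : (if 0 < M then 1 else 0) % W = if 0 < M then 1 else 0 :=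
      Nat.mod_eq_of_lt (by split_ifs <;> omega)
    simp only [Prog.exec, Op.eval, setReg_reg, if_true, h.2, hN', e2]

theorem Ends.forLoop {N M : ℕ} (hM : M < W) (h1 : 1 < W) {body : Prog} (hbody : body.Straight)
    {I : ℕ → Memory → Prop} (hN : N ≠ 3 ∧ N ≠ 4)
    (hI : ∀ i μ, I i μ → μ.reg 2 = 1 ∧ μ.reg N = M) (hst : ∀ i, LoopStable (I i))
    (hstep : ∀ i < M, ∀ μ, I i μ → μ.reg 3 = i →
      I (i + 1) (body.exec W μ) ∧ (body.exec W μ).reg 3 = i)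
    (hμ : I 0 μ) : Ends W (RandRAM.forLoop N body) μ (M * (body.size + 5) + 5) (I M) := by
  have h := Impl.forLoop (A := Unit) (W := W) (μ := μ) (I := fun i _ => I i)
    (g := fun _ _ => .leaf ()) hM h1 hN (fun i _ => hI i) (fun i _ => hst i)
    (fun i hi _ μ' hμ' h3 => Impl.straight hbody (hstep i hi μ' hμ' h3)) (a := ()) hμ
  have e : ∀ m i, iter (fun _ _ => CoinTree.leaf ()) i m () = .leaf () := by
    intro m
    induction m with
    | zero => exact fun i => rfl
    | succ m ih => exact fun i => ih (i + 1)
  rwa [e] at h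

/-- Execute `f 0`, …, `f (m - 1)`. -/
def unroll (f : ℕ → Prog) : ℕ → Prog
  | 0 => .skip
  | m + 1 => .seq (unroll f m) (f m)

theorem straight_unroll {f : ℕ → Prog} (hf : ∀ j, (f j).Straight) (m : ℕ) :
    (unroll f m).Straight := by
  induction m with
  | zero => trivial
  | succ m ih => exact ⟨ih, hf m⟩

theorem exec_unroll {f : ℕ → Prog} {J : ℕ → Memory → Prop} {m : ℕ}
    (hf : ∀ j < m, ∀ μ, J j μ → J (j + 1) ((f j).exec W μ)) (hμ : J 0 μ) :
    J m ((unroll f m).exec W μ) := by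
  induction m with
  | zero => exact hμ
  | succ m ih => exact hf m (by omega) _ (ih fun j hj => hf j (by omega))

/-- Append `s` random bits to the binary expansion in register `16`. -/
def tosses : ℕ → Prog
  | 0 => .skip
  | s + 1 => .seq (.flip 6) (.seq (.seq (.op .add 16 16 16) (.op .add 16 16 6)) (tosses s))

/-- The hypothesis bounds all numbers met while `s` bits are appended, so no doubling is reduced
modulo `W`. -/
theorem Impl.tosses {s : ℕ} (hs : 2 ^ s * (μ.reg 16 + 1) ≤ W) :
    Impl W (tosses s) μ (7 * s + 1) (CoinTree.uniform s (μ.reg 16)) fun k μ' =>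
      μ'.arr = μ.arr ∧ μ'.reg 16 = k ∧ ∀ i, i ≠ 6 → i ≠ 16 → μ'.reg i = μ.reg i := by
  induction s generalizing μ with
  | zero => exact Impl.straight (p := .skip) trivial ⟨rfl, rfl, fun _ _ _ => rfl⟩
  | succ s ih =>
    have hp : 1 ≤ 2 ^ s := Nat.one_le_two_pow
    have hs' : 2 ^ s * (2 * μ.reg 16 + 2) ≤ W := le_trans (le_of_eq (by ring)) hs
    have hW : 2 * μ.reg 16 + 2 ≤ W := le_trans (Nat.le_mul_of_pos_left _ hp) hs'
    have hrest : ∀ b : Bool, Impl W (.seq (.seq (.op .add 16 16 16) (.op .add 16 16 6)) (tosses s))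
        (μ.setReg 6 (b.toNat % W)) (7 * s + 5)
        (CoinTree.uniform s (2 * μ.reg 16 + b.toNat)) fun k μ' =>
          μ'.arr = μ.arr ∧ μ'.reg 16 = k ∧ ∀ i, i ≠ 6 → i ≠ 16 → μ'.reg i = μ.reg i := by
      intro b
      have hb : b.toNat ≤ 1 := by cases b <;> simp
      have e0 : b.toNat % W = b.toNat := Nat.mod_eq_of_lt (by omega)
      have e1 : (μ.reg 16 + μ.reg 16) % W = 2 * μ.reg 16 := by
        rw [← two_mul]
        exact Nat.mod_eq_of_lt (by omega)
      have e2 : (2 * μ.reg 16 + b.toNat) % W = 2 * μ.reg 16 + b.toNat :=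
        Nat.mod_eq_of_lt (by omega)
      refine (Ends.seq (Ends.straight (p := .seq (.op .add 16 16 16) (.op .add 16 16 6))
        ⟨trivial, trivial⟩ (Q := fun μ' => μ'.arr = μ.arr ∧ μ'.reg 16 = 2 * μ.reg 16 + b.toNat ∧
          ∀ i, i ≠ 6 → i ≠ 16 → μ'.reg i = μ.reg i) ?_) (k₂ := 7 * s + 1) fun μ' h => ?_).weaken
          (fun _ _ h => h) (by simp only [Prog.size]; omega)
      · refine ⟨rfl, ?_, fun i h6 h16 => ?_⟩
        · simp [Prog.exec, Op.eval, e0, e1, e2]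
        · simp [Prog.exec, h6, h16]
      · have h' := ih (μ := μ') (by
          rw [h.2.1]
          refine le_trans (Nat.mul_le_mul_left _ ?_) hs'
          omega)
        rw [h.2.1] at h'
        refine h'.weaken (fun k μ'' hk => ⟨hk.1.trans h.1, hk.2.1, fun i h6 h16 => ?_⟩) le_rfl
        rw [hk.2.2 i h6 h16, h.2.2 i h6 h16]
    have h := Impl.seq (Impl.flip (W := W) (μ := μ) (i := 6) (Q := fun b μ' => μ' = μ.setReg 6 (b.toNat % W)) fun b => rfl)
      (t' := fun b => CoinTree.uniform s (2 * μ.reg 16 + b.toNat)) (k₂ := 7 * s + 5)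
        fun b μ' h => h ▸ hrest b
    exact h.weaken (fun _ _ h => h) (by omega)

end RandRAM

/-! ### Inspecting constraints and gathering candidates -/

namespace RandRAM

open RegularBipartiteGraph

variable {c d n r W : ℕ} (G : RegularBipartiteGraph c d n r)

/-- Register `2` contains `1`, and the description of the graph is in its place. -/
structure Base (μ : Memory) : Prop where
  one : μ.reg 2 = 1
  left_size : μ.reg 0 = n
  right_size : μ.reg 1 = r
  right : ∀ (u : Fin r) (j : Fin d), μ.arr (1 + j) u = G.nbrOfRight u j
  left : ∀ (v : Fin n) (j : Fin c), μ.arr (1 + d + j) v = G.nbrOfLeft v j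

/-- Array `a` contains the word `z`. -/
def HasWord (a : ℕ) (z : Fin n → ZMod 2) (μ : Memory) : Prop := ∀ v : Fin n, μ.arr a v = (z v).val

/-- Array `a` starts with the list `l`. -/
def HasList (a : ℕ) (l : List (Fin n)) (μ : Memory) : Prop :=
  ∀ (i : ℕ) (h : i < l.length), μ.arr a i = l[i]

variable {G} {μ μ' : Memory}

theorem Base.congr (h : Base G μ) (hreg : ∀ i < 3, μ'.reg i = μ.reg i)
    (harr : ∀ a, 0 < a → a < 1 + d + c → ∀ i, μ'.arr a i = μ.arr a i) : Base G μ' where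
  one := by rw [hreg 2 (by norm_num), h.one]
  left_size := by rw [hreg 0 (by norm_num), h.left_size]
  right_size := by rw [hreg 1 (by norm_num), h.right_size]
  right u j := by rw [harr _ (by omega) (by have := j.2; omega), h.right]
  left v j := by rw [harr _ (by omega) (by have := j.2; omega), h.left]

theorem Base.setReg (h : Base G μ) {i w : ℕ} (hi : 3 ≤ i) : Base G (μ.setReg i w) :=
  h.congr (fun j hj => by rw [setReg_reg, if_neg (by omega)]) fun _ _ _ _ => rfl

theorem Base.setArr (h : Base G μ) {a i w : ℕ} (ha : a = 0 ∨ 1 + d + c ≤ a) :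
    Base G (μ.setArr a i w) :=
  h.congr (fun j hj => rfl) fun b h0 h1 j => by rw [setArr_arr, if_neg (by omega)]

variable (C : Submodule (ZMod 2) (Fin d → ZMod 2)) (D : (Fin d → ZMod 2) → Option (Fin d))

open Classical in
/-- The verdict on a subword: register `19` tells whether it is in `C`, and register `7` whether
the constraint in register `5` votes for a variable, which is then put into register `8`. -/
noncomputable def verdict (w : Fin d → ZMod 2) : Prog :=
  .seq (.const 19 (if w ∈ C then 1 else 0))
    (match D w with
      | none => .const 7 0
      | some j => .seq (.const 7 1) (.load 8 (1 + j) 5))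

/-- Read the first `k` bits of the subword at the constraint in register `5`, from the word in
array `a`, and give the verdict. The other bits are those of `w`. -/
noncomputable def inspect (a : ℕ) : ℕ → (ℕ → ZMod 2) → Prog
  | 0, w => verdict C D fun j => w j
  | k + 1, w => .seq (.seq (.load 6 (1 + k) 5) (.load 6 a 6))
      (.cond 6 (inspect a k (Function.update w k 1)) (inspect a k (Function.update w k 0)))

theorem straight_inspect (a k : ℕ) (w : ℕ → ZMod 2) : (inspect C D a k w).Straight := by
  induction k generalizing w with
  | zero =>
    rw [inspect, verdict]
    refine ⟨trivial, ?_⟩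
    split <;> simp [Prog.Straight]
  | succ k ih => exact ⟨⟨trivial, trivial⟩, ih _, ih _⟩

open Classical in
/-- The effect of `inspect`. -/
structure Inspected (G : RegularBipartiteGraph c d n r) (z : Fin n → ZMod 2) (u : Fin r)
    (μ μ' : Memory) : Prop where
  arr : μ'.arr = μ.arr
  reg : ∀ i, i ≠ 6 → i ≠ 7 → i ≠ 8 → i ≠ 19 → μ'.reg i = μ.reg i
  code : μ'.reg 19 = if G.view z u ∈ C then 1 else 0
  votes : μ'.reg 7 = if (G.vote D z u).isSome then 1 else 0
  target : ∀ v, G.vote D z u = some v → μ'.reg 8 = v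

open Classical in
theorem inspected (hW : 1 < W) {a : ℕ} {z : Fin n → ZMod 2} {u : Fin r} (hb : Base G μ)
    (hz : HasWord a z μ) (hu : μ.reg 5 = u) :
    Inspected C D G z u μ ((inspect C D a d 0).exec W μ) := by
  -- The program is a decision tree. The bits at positions `≥ k` have been read and recorded in `w`;
  -- at `k = 0` the view is known and the verdict is built into the leaf.
  have key : ∀ k ≤ d, ∀ (w : ℕ → ZMod 2) (μ : Memory), Base G μ → HasWord a z μ → μ.reg 5 = u →
      (∀ j : Fin d, k ≤ j → w j = G.view z u j) →
      Inspected C D G z u μ ((inspect C D a k w).exec W μ) := by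
    intro k
    induction k with
    | zero =>
      intro _ w μ hb hz hu hw
      have hw' : (fun j : Fin d => w j) = G.view z u := funext fun j => hw j (Nat.zero_le _)
      have h1 : 1 % W = 1 := Nat.mod_eq_of_lt hW
      have hif : (if G.view z u ∈ C then 1 else 0) % W = if G.view z u ∈ C then 1 else 0 :=
        Nat.mod_eq_of_lt (by split_ifs <;> omega)
      rw [inspect, hw', verdict]
      rcases hD : D (G.view z u) with _ | j
      · constructor
        · simp [Prog.exec]
        · intro i h6 h7 h8 h19
          simp [Prog.exec, h7, h19]
        · simp [Prog.exec, hif]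
        · simp [Prog.exec, vote, hD]
        · simp [vote, hD]
      · constructor
        · simp [Prog.exec]
        · intro i h6 h7 h8 h19
          simp [Prog.exec, h7, h8, h19]
        · simp [Prog.exec, hif]
        · simp [Prog.exec, vote, hD, h1]
        · intro v hv
          simp only [vote, hD, Option.map_some, Option.some.injEq] at hv
          simp [Prog.exec, hu, hb.right, hv]
    | succ k ih =>
      intro hk w μ hb hz hu hw
      have hload : μ.arr a (μ.arr (1 + k) (μ.reg 5)) = (G.view z u ⟨k, hk⟩).val := by
        have := hb.right u ⟨k, hk⟩
        rw [hu, this, hz]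
        rfl
      rw [inspect, Prog.exec]
      set μ₁ := (Prog.seq (.load 6 (1 + k) 5) (.load 6 a 6)).exec W μ with hμ₁
      rw [Prog.exec]
      have h6 : μ₁.reg 6 = (G.view z u ⟨k, hk⟩).val := by
        simp [hμ₁, Prog.exec, ← hload]
      have harr : μ₁.arr = μ.arr := by simp [hμ₁, Prog.exec]
      have hreg : ∀ i, i ≠ 6 → μ₁.reg i = μ.reg i := fun i hi => by simp [hμ₁, Prog.exec, hi]
      have hb₁ : Base G μ₁ := hb.congr (fun i hi => hreg i (by omega)) fun _ _ _ _ => by rw [harr]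
      have hz₁ : HasWord a z μ₁ := fun v => by rw [harr, hz]
      have hu₁ : μ₁.reg 5 = u := by rw [hreg 5 (by norm_num), hu]
      have fin : ∀ w' : ℕ → ZMod 2, (∀ j : Fin d, k ≤ j → w' j = G.view z u j) →
          Inspected C D G z u μ ((inspect C D a k w').exec W μ₁) := fun w' hw' => by
        have h := ih (by omega) w' μ₁ hb₁ hz₁ hu₁ hw'
        exact ⟨h.arr.trans harr, fun i h6 h7 h8 h19 => (h.reg i h6 h7 h8 h19).trans (hreg i h6),
          h.code, h.votes, h.target⟩
      have hupd : ∀ b, b = G.view z u ⟨k, hk⟩ → ∀ j : Fin d, k ≤ j →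
          Function.update w k b (j : ℕ) = G.view z u j := by
        intro b hb' j hj
        rcases eq_or_lt_of_le hj with hj | hj
        · subst hj
          rw [Function.update_self, hb']
        · rw [Function.update_of_ne (by omega)]
          exact hw j hj
      have hbit : ∀ b : ZMod 2, (b.val ≠ 0 → 1 = b) ∧ (¬ b.val ≠ 0 → 0 = b) := by decide
      split_ifs with h
      · exact fin _ (hupd 1 ((hbit _).1 (h6 ▸ h)))
      · exact fin _ (hupd 0 ((hbit _).2 (h6 ▸ h)))
  exact key d le_rfl 0 μ hb hz hu fun j hj => absurd j.2 (by omega)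

/-- What the memory contains during a round: array `0` the received word `w`, array `1 + d + c`
the current word `z`, array `1 + d + c + 2` the list `N` of length in register `12`, array
`1 + d + c + 3` marks at the elements of `M`, and register `13` the fuel. -/
structure State (G : RegularBipartiteGraph c d n r) (w z : Fin n → ZMod 2) (N M : List (Fin n))
    (fuel : ℕ) (μ : Memory) : Prop where
  base : Base G μ
  input : HasWord 0 w μ
  word : HasWord (1 + d + c) z μ
  list : HasList (1 + d + c + 2) N μ
  length : μ.reg 12 = N.length
  mark : ∀ v : Fin n, μ.arr (1 + d + c + 3) v = if v ∈ M then 1 else 0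
  fuel_eq : μ.reg 13 = fuel

variable {w z : Fin n → ZMod 2} {N M L : List (Fin n)} {fuel : ℕ}

theorem State.congr (h : State G w z N M fuel μ) (harr : μ'.arr = μ.arr)
    (hreg : ∀ i, i < 3 ∨ i = 12 ∨ i = 13 → μ'.reg i = μ.reg i) : State G w z N M fuel μ' where
  base := h.base.congr (fun i hi => hreg i (Or.inl hi)) fun _ _ _ _ => by rw [harr]
  input v := by rw [harr, h.input]
  word v := by rw [harr, h.word]
  list i hi := by rw [harr, h.list]
  length := by rw [hreg 12 (by simp), h.length]
  mark v := by rw [harr, h.mark]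
  fuel_eq := by rw [hreg 13 (by simp), h.fuel_eq]

theorem State.setReg (h : State G w z N M fuel μ) {i v : ℕ}
    (hi : 3 ≤ i ∧ i ≠ 12 ∧ i ≠ 13) : State G w z N M fuel (μ.setReg i v) :=
  h.congr rfl fun j hj => by rw [setReg_reg, if_neg (by omega)]

theorem State.setArr (h : State G w z N M fuel μ) {a i v : ℕ}
    (ha : a = 1 + d + c + 1 ∨ a = 1 + d + c + 4) : State G w z N M fuel (μ.setArr a i v) where
  base := h.base.setArr (by omega)
  input v := by rw [setArr_arr, if_neg (by omega), h.input]
  word v := by rw [setArr_arr, if_neg (by omega), h.word]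
  list i hi := by rw [setArr_arr, if_neg (by omega), h.list]
  length := h.length
  mark v := by rw [setArr_arr, if_neg (by omega), h.mark]
  fuel_eq := h.fuel_eq

/-- A variable is appended to the list and marked. -/
theorem State.push (h : State G w z N N fuel μ) {v : Fin n} :
    State G w z (N ++ [v]) (N ++ [v]) fuel
      (((μ.setArr (1 + d + c + 3) v 1).setArr (1 + d + c + 2) N.length v).setReg 12
        (N.length + 1)) where
  base := ((h.base.setArr (by omega)).setArr (by omega)).setReg (by omega)
  input v := by rw [setReg_arr, setArr_arr, if_neg (by omega), setArr_arr, if_neg (by omega),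
    h.input]
  word v := by rw [setReg_arr, setArr_arr, if_neg (by omega), setArr_arr, if_neg (by omega), h.word]
  list i hi := by
    rw [setReg_arr, setArr_arr]
    rw [List.length_append, List.length_singleton] at hi
    split_ifs with h'
    · simp [h'.2]
    · have hi' : i < N.length := by omega
      rw [setArr_arr, if_neg (by omega), h.list i hi', List.getElem_append_left hi']
  length := by simp
  mark w := by
    rw [setReg_arr, setArr_arr, if_neg (by omega), setArr_arr, h.mark]
    by_cases hwv : w = v
    · simp [hwv]
    · simp [hwv, Fin.val_inj]
  fuel_eq := by simpa using h.fuel_eq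

/-- A mark is deleted. -/
theorem State.unmark {v : Fin n} (h : State G w z N (v :: M) fuel μ) (hv : v ∉ M) :
    State G w z N M fuel (μ.setArr (1 + d + c + 3) v 0) where
  base := h.base.setArr (by omega)
  input v := by rw [setArr_arr, if_neg (by omega), h.input]
  word v := by rw [setArr_arr, if_neg (by omega), h.word]
  list i hi := by rw [setArr_arr, if_neg (by omega), h.list]
  length := h.length
  mark w := by
    rw [setArr_arr, h.mark]
    by_cases hwv : w = v
    · simp [hwv, hv]
    · simp [hwv, Fin.val_inj]
  fuel_eq := h.fuel_eq

/-- A bit of the current word is flipped. -/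
theorem State.flipAt (h : State G w z N M fuel μ) (v : Fin n) :
    State G w (flipAt z v) N M fuel (μ.setArr (1 + d + c) v (1 - (z v).val)) where
  base := h.base.setArr (by omega)
  input v := by rw [setArr_arr, if_neg (by omega), h.input]
  word w := by
    rw [setArr_arr, RegularBipartiteGraph.flipAt]
    by_cases hwv : w = v
    · subst hwv
      have : ∀ b : ZMod 2, 1 - b.val = (b + 1).val := by decide
      simp [this]
    · simp [hwv, Fin.val_inj, h.word w]
  list i hi := by rw [setArr_arr, if_neg (by omega), h.list]
  length := h.length
  mark v := by rw [setArr_arr, if_neg (by omega), h.mark]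
  fuel_eq := h.fuel_eq

/-- Register `5` gets the neighbour number `j` of the variable in register `9`, and this constraint
is inspected. -/
noncomputable def ask (c j : ℕ) : Prog :=
  .seq (.load 5 (1 + d + j) 9) (inspect C D (1 + d + c) d 0)

theorem asked (hW : 1 < W) {v : Fin n} {j : Fin c} (hb : Base G μ) (hz : HasWord (1 + d + c) z μ)
    (hv : μ.reg 9 = v) :
    Inspected C D G z (G.nbrOfLeft v j) (μ.setReg 5 (G.nbrOfLeft v j : ℕ))
      ((ask C D c j).exec W μ) := by
  rw [ask, Prog.exec, Prog.exec, hv, hb.left]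
  exact inspected C D hW (hb.setReg (by omega)) hz (by simp)

theorem straight_ask (j : ℕ) : (ask C D c j).Straight := ⟨trivial, straight_inspect C D _ _ _⟩

/-- Append the vote of the neighbour number `j` to the list. -/
noncomputable def gatherAt (c j : ℕ) : Prog :=
  .seq (ask C D c j) (.cond 7 (.seq (.load 6 (1 + d + c + 3) 8)
    (.cond 6 .skip (.seq (.seq (.store (1 + d + c + 3) 8 2) (.store (1 + d + c + 2) 12 8))
      (.op .add 12 12 2)))) .skip)

noncomputable def gatherBody (c : ℕ) : Prog :=
  .seq (.load 9 (1 + d + c + 1) 3) (unroll (gatherAt C D c) c)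

theorem straight_gatherBody : (gatherBody C D c).Straight :=
  ⟨trivial, straight_unroll (fun j => by
    simp [gatherAt, Prog.Straight, straight_ask]) c⟩

/-- Marks decide membership in constant time; they mirror the list, so `N` occurs twice in `State`.
Distinctness of the entries keeps the length below `W`. -/
theorem exec_gatherAt (hW : 1 < W) (hn : n < W) {v : Fin n} {j : Fin c} (hN : N.Nodup)
    (h : State G w z N N fuel μ) (hv : μ.reg 9 = v) :
    State G w z (push N (G.vote D z (G.nbrOfLeft v j))) (push N (G.vote D z (G.nbrOfLeft v j))) fuel
        ((gatherAt C D c j).exec W μ) ∧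
      ((gatherAt C D c j).exec W μ).arr (1 + d + c + 1) = μ.arr (1 + d + c + 1) ∧
      (∀ i, i = 3 ∨ i = 9 ∨ i = 11 → ((gatherAt C D c j).exec W μ).reg i = μ.reg i) := by
  rw [gatherAt, Prog.exec]
  have hask := asked (W := W) (C := C) (D := D) (j := j) hW h.base h.word hv
  set μ₁ := (ask C D c j).exec W μ
  have harr : μ₁.arr = μ.arr := hask.arr
  have hreg : ∀ i, i ≠ 5 → i ≠ 6 → i ≠ 7 → i ≠ 8 → i ≠ 19 → μ₁.reg i = μ.reg i :=
    fun i h5 h6 h7 h8 h19 => (hask.reg i h6 h7 h8 h19).trans (by simp [h5])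
  have h₁ : State G w z N N fuel μ₁ :=
    h.congr harr fun i hi => hreg i (by omega) (by omega) (by omega) (by omega) (by omega)
  have hregs : ∀ i, i = 3 ∨ i = 9 ∨ i = 11 → μ₁.reg i = μ.reg i :=
    fun i hi => hreg i (by omega) (by omega) (by omega) (by omega) (by omega)
  have h7 := hask.votes
  rcases hvote : G.vote D z (G.nbrOfLeft v j) with _ | x
  · rw [hvote] at h7
    have h7' : μ₁.reg 7 = 0 := by simpa using h7
    simp only [Prog.exec, h7', ne_eq, not_true, if_false]
    exact ⟨h₁, by rw [harr], hregs⟩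
  · rw [hvote] at h7
    have h7' : μ₁.reg 7 = 1 := by simpa using h7
    have h8 : μ₁.reg 8 = x := hask.target x hvote
    have hm := h₁.mark x
    simp only [Prog.exec, h7', h8, hm, ne_eq, one_ne_zero, not_false_eq_true, if_true, setReg_reg,
      RegularBipartiteGraph.push]
    by_cases hx : x ∈ N
    · simp only [hx, if_true, one_ne_zero, not_false_eq_true]
      refine ⟨h₁.setReg (by omega), by rw [setReg_arr, harr], fun i hi => ?_⟩
      rw [setReg_reg, if_neg (by omega), hregs i hi]
    · simp only [hx, if_false, not_true]
      have hlen : N.length < W := lt_of_le_of_lt (by simpa using hN.length_le_card) hn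
      have hlen1 : N.length + 1 ≤ n := by
        have := (List.nodup_cons.2 ⟨hx, hN⟩).length_le_card
        simpa using this
      have h₂ : State G w z N N fuel (μ₁.setReg 6 0) := h₁.setReg (by omega)
      have h12 : (N.length + 1) % W = N.length + 1 := Nat.mod_eq_of_lt (by omega)
      simp only [Op.eval, setArr_reg, setReg_reg, h₁.base.one, h₁.length, h8]
      norm_num only [if_false, if_true]
      rw [h12]
      refine ⟨h₂.push, ?_, fun i hi => ?_⟩
      · funext i
        rw [setReg_arr, setArr_arr, if_neg (by omega), setArr_arr, if_neg (by omega), setReg_arr,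
          harr]
      · rw [if_neg (by omega), if_neg (by omega), hregs i hi]

/-- The list of the variables with votes is computed. -/
noncomputable def gather (c : ℕ) : Prog := .seq (.const 12 0) (forLoop 11 (gatherBody C D c))

theorem ends_gather (hW : 1 < W) (hn : n < W) (hL : L.length < W)
    (h : State G w z N [] fuel μ) (hlist : HasList (1 + d + c + 1) L μ)
    (hlen : μ.reg 11 = L.length) :
    Ends W (gather C D c) μ (L.length * ((gatherBody C D c).size + 5) + 7)
      (State G w z (G.collect D z L) (G.collect D z L) fuel) := by
  refine (Ends.seq (k₁ := 1) (k₂ := L.length * ((gatherBody C D c).size + 5) + 5)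
    (Q := fun μ' => State G w z [] [] fuel μ' ∧ HasList (1 + d + c + 1) L μ' ∧
      μ'.reg 11 = L.length) (Ends.straight (p := .const 12 0) trivial ?_)
    fun μ' h' => ?_).weaken (fun _ _ h => h) (by omega)
  · refine ⟨⟨h.base.setReg (by omega), h.input, h.word, fun i hi => absurd hi (by simp), ?_,
      h.mark, ?_⟩, hlist, ?_⟩
    · simp [Prog.exec]
    · simp [Prog.exec, h.fuel_eq]
    · simp [Prog.exec, hlen]
  · refine (Ends.forLoop (W := W) (μ := μ') hL hW (straight_gatherBody C D) (I := fun i μ =>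
      State G w z (G.collect D z (L.take i)) (G.collect D z (L.take i)) fuel μ ∧
        HasList (1 + d + c + 1) L μ ∧ μ.reg 11 = L.length) (by norm_num)
      (fun i μ hI => ⟨hI.1.base.one, hI.2.2⟩) ?_ ?_ ?_).weaken (fun μ hI => ?_) le_rfl
    · intro i μ k x hk hI
      exact ⟨hI.1.setReg (by omega), hI.2.1, by rw [setReg_reg, if_neg (by omega), hI.2.2]⟩
    · intro i hi μ hI h3
      have htake : L.take (i + 1) = L.take i ++ [L[i]] := (List.take_concat_get' L i hi).symm
      rw [htake, collect_append_singleton, gatherBody, Prog.exec]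
      have hJ := exec_unroll (W := W) (f := gatherAt C D c) (m := c)
        (J := fun k μ =>
          State G w z (G.collectAt D z L[i] (G.collect D z (L.take i)) k)
            (G.collectAt D z L[i] (G.collect D z (L.take i)) k) fuel μ ∧
          HasList (1 + d + c + 1) L μ ∧ μ.reg 11 = L.length ∧ μ.reg 3 = i ∧ μ.reg 9 = L[i])
        (μ := (Prog.load 9 (1 + d + c + 1) 3).exec W μ) ?_ ?_
      · exact ⟨⟨hJ.1, hJ.2.1, hJ.2.2.1⟩, hJ.2.2.2.1⟩
      · rintro k hk μ ⟨hs, hl, h11, h3, h9⟩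
        obtain ⟨e1, e2, e3⟩ := exec_gatherAt (W := W) C D (j := ⟨k, hk⟩) hW hn
          (G.nodup_collectAt (G.nodup_collect z _) k) hs h9
        rw [collectAt, dif_pos hk]
        refine ⟨e1, fun i hi => ?_, ?_, ?_, ?_⟩
        · rw [e2, hl]
        · rw [e3 11 (by simp), h11]
        · rw [e3 3 (by simp), h3]
        · rw [e3 9 (by simp), h9]
      · refine ⟨hI.1.setReg (by omega), hI.2.1, ?_, ?_, ?_⟩
        · simp [Prog.exec, hI.2.2]
        · simp [Prog.exec, h3]
        · simp [Prog.exec, h3, hI.2.1 i hi]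
    · simpa [collect] using h'
    · simpa using hI.1

end RandRAM

namespace CoinTree

theorem bind_assoc {A B E : Type} (t : CoinTree A) (f : A → CoinTree B) (g : B → CoinTree E) :
    (t.bind f).bind g = t.bind fun a => (f a).bind g := by
  induction t with
  | leaf a => rfl
  | toss s t hs ht => simp only [bind, hs, ht]

end CoinTree

/-! ### Counting votes, flipping, and the cost of rounds -/

namespace RandRAM

open RegularBipartiteGraph

variable {c d n r W : ℕ} {G : RegularBipartiteGraph c d n r} {μ μ' : Memory}
  (C : Submodule (ZMod 2) (Fin d → ZMod 2)) (D : (Fin d → ZMod 2) → Option (Fin d))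
  {w z : Fin n → ZMod 2} {N M L : List (Fin n)} {fuel : ℕ}

/-- Register `15` is increased if the neighbour number `j` of the variable in register `9` votes
for this variable. -/
noncomputable def tallyAt (c j : ℕ) : Prog :=
  .seq (ask C D c j) (.cond 7 (.seq (.seq (.op .lt 6 8 9) (.op .lt 10 9 8))
    (.seq (.op .add 6 6 10) (.cond 6 .skip (.op .add 15 15 2)))) .skip)

/-- Equality of two words is tested by two strict comparisons, whose results add up to `0` exactly
when the words agree. -/
theorem exec_tallyAt (hW : 1 < W) {v : Fin n} {j : Fin c} {m : ℕ} (hb : Base G μ)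
    (hz : HasWord (1 + d + c) z μ) (hv : μ.reg 9 = v) (hm : μ.reg 15 = m) (hmW : m + 1 < W) :
    ((tallyAt C D c j).exec W μ).arr = μ.arr ∧
      (∀ i, i < 4 ∨ i = 9 ∨ i = 12 ∨ i = 13 →
        ((tallyAt C D c j).exec W μ).reg i = μ.reg i) ∧
      ((tallyAt C D c j).exec W μ).reg 15 =
        if G.vote D z (G.nbrOfLeft v j) = some v then m + 1 else m := by
  rw [tallyAt, Prog.exec]
  have hask := asked (W := W) (C := C) (D := D) (j := j) hW hb hz hv
  set μ₁ := (ask C D c j).exec W μ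
  have harr : μ₁.arr = μ.arr := hask.arr
  have hreg : ∀ i, i ≠ 5 → i ≠ 6 → i ≠ 7 → i ≠ 8 → i ≠ 19 → μ₁.reg i = μ.reg i :=
    fun i h5 h6 h7 h8 h19 => (hask.reg i h6 h7 h8 h19).trans (by simp [h5])
  have hregs : ∀ i, i < 4 ∨ i = 9 ∨ i = 12 ∨ i = 13 → μ₁.reg i = μ.reg i :=
    fun i hi => hreg i (by omega) (by omega) (by omega) (by omega) (by omega)
  have h15 : μ₁.reg 15 = m := (hreg 15 (by simp) (by simp) (by simp) (by simp) (by simp)).trans hm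
  have h9 : μ₁.reg 9 = v := (hregs 9 (by simp)).trans hv
  have h2 : μ₁.reg 2 = 1 := (hregs 2 (by simp)).trans hb.one
  have h7 := hask.votes
  rcases hvote : G.vote D z (G.nbrOfLeft v j) with _ | x
  · rw [hvote] at h7
    have h7' : μ₁.reg 7 = 0 := by simpa using h7
    simp only [Prog.exec, h7', ne_eq, not_true, if_false]
    exact ⟨harr, hregs, by simp [h15]⟩
  · rw [hvote] at h7
    have h7' : μ₁.reg 7 = 1 := by simpa using h7
    have h8 : μ₁.reg 8 = x := hask.target x hvote
    have hmm : (m + 1) % W = m + 1 := Nat.mod_eq_of_lt hmW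
    rcases lt_trichotomy (x : ℕ) v with hx | hx | hx
    · have hx' : x ≠ v := fun e => by simp [e] at hx
      simp [Prog.exec, Op.eval, h7', h8, h9, hx, not_lt.2 hx.le, hx', h15, harr,
        Nat.mod_eq_of_lt hW]
      intro i hi
      rw [if_neg (by omega), if_neg (by omega), if_neg (by omega), hregs i hi]
    · have hx' : x = v := Fin.ext hx
      simp [Prog.exec, Op.eval, h7', h8, h9, hx', h15, harr, h2, hmm]
      intro i hi
      rw [if_neg (by omega), if_neg (by omega), if_neg (by omega), if_neg (by omega), hregs i hi]
    · have hx' : x ≠ v := fun e => by simp [e] at hx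
      simp [Prog.exec, Op.eval, h7', h8, h9, hx, not_lt.2 hx.le, hx', h15, harr,
        Nat.mod_eq_of_lt hW]
      intro i hi
      rw [if_neg (by omega), if_neg (by omega), if_neg (by omega), hregs i hi]

/-- Along with the count, the entry is copied to the array that the next round reads and its mark is
erased, so cleaning up costs no more than the list. -/
noncomputable def tallyBody (c : ℕ) : Prog :=
  .seq (.seq (.load 9 (1 + d + c + 2) 3) (.const 15 0))
    (.seq (unroll (tallyAt C D c) c)
      (.seq (.seq (.store (1 + d + c + 4) 3 15) (.store (1 + d + c + 1) 3 9))
        (.seq (.const 10 0) (.store (1 + d + c + 3) 9 10))))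

theorem straight_tallyBody : (tallyBody C D c).Straight := by
  simp only [tallyBody, Prog.Straight, true_and, and_true]
  exact straight_unroll (fun j => by simp [tallyAt, Prog.Straight, straight_ask]) c

theorem card_filter_lt_succ {P : Fin c → Prop} [DecidablePred P] {k : ℕ} (hk : k < c) :
    (Finset.univ.filter fun j : Fin c => (j : ℕ) < k + 1 ∧ P j).card =
      if P ⟨k, hk⟩ then (Finset.univ.filter fun j : Fin c => (j : ℕ) < k ∧ P j).card + 1
      else (Finset.univ.filter fun j : Fin c => (j : ℕ) < k ∧ P j).card := by
  split_ifs with h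
  · rw [← Finset.card_insert_of_notMem (a := (⟨k, hk⟩ : Fin c)) (by simp)]
    congr 1
    ext j
    simp only [Finset.mem_filter, Finset.mem_univ, true_and, Finset.mem_insert, Fin.ext_iff]
    constructor
    · rintro ⟨hj, hP⟩
      rcases Nat.lt_succ_iff_lt_or_eq.1 hj with hj | hj
      · exact Or.inr ⟨hj, hP⟩
      · exact Or.inl hj
    · rintro (hj | ⟨hj, hP⟩)
      · obtain rfl : j = ⟨k, hk⟩ := Fin.ext hj
        exact ⟨by simp, h⟩
      · exact ⟨by omega, hP⟩
  · congr 1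
    ext j
    simp only [Finset.mem_filter, Finset.mem_univ, true_and]
    constructor
    · rintro ⟨hj, hP⟩
      rcases Nat.lt_succ_iff_lt_or_eq.1 hj with hj | hj
      · exact ⟨hj, hP⟩
      · obtain rfl : j = ⟨k, hk⟩ := Fin.ext hj
        exact absurd hP h
    · rintro ⟨hj, hP⟩
      exact ⟨by omega, hP⟩

/-- The votes for the variables of a list are counted, and the list is moved. -/
noncomputable def tally (c : ℕ) : Prog := forLoop 12 (tallyBody C D c)

/-- Array `1 + d + c + 4` contains the numbers `m v` for the elements `v` of the list. -/
def HasTally (c d : ℕ) (N : List (Fin n)) (m : Fin n → ℕ) (μ : Memory) : Prop :=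
  ∀ (k : ℕ) (hk : k < N.length), μ.arr (1 + d + c + 4) k = m N[k]

theorem HasList.append {a : ℕ} {l : List (Fin n)} {v : Fin n} (h : HasList a l μ) :
    HasList a (l ++ [v]) (μ.setArr a l.length v) := by
  intro i hi
  rw [List.length_append, List.length_singleton] at hi
  rw [setArr_arr]
  split_ifs with h'
  · simp [h'.2]
  · have hi' : i < l.length := by
      have : i ≠ l.length := fun e => h' ⟨rfl, e⟩
      omega
    rw [h i hi', List.getElem_append_left hi']

theorem HasTally.append {l : List (Fin n)} {m : Fin n → ℕ} {v : Fin n}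
    (h : HasTally c d l m μ) :
    HasTally c d (l ++ [v]) m (μ.setArr (1 + d + c + 4) l.length (m v)) := by
  intro i hi
  rw [List.length_append, List.length_singleton] at hi
  rw [setArr_arr]
  split_ifs with h'
  · simp [h'.2]
  · have hi' : i < l.length := by
      have : i ≠ l.length := fun e => h' ⟨rfl, e⟩
      omega
    rw [h i hi', List.getElem_append_left hi']

/-- All counts refer to the word before the flips. After `i` passes the first `i` entries have been
moved and counted, and the marks are those of the remaining entries. -/
theorem ends_tally (hW : 1 < W) (hn : n < W) (hc : c + 1 < W) (hN : N.Nodup)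
    (h : State G w z N N fuel μ) :
    Ends W (tally C D c) μ (N.length * ((tallyBody C D c).size + 5) + 5) fun μ' =>
      State G w z N [] fuel μ' ∧ HasList (1 + d + c + 1) N μ' ∧
        HasTally c d N (G.votes D z) μ' := by
  have hlen : N.length ≤ n := by simpa using hN.length_le_card
  refine (Ends.forLoop (W := W) (μ := μ) (M := N.length) (by omega) hW (straight_tallyBody C D)
    (I := fun i μ => State G w z N (N.drop i) fuel μ ∧ HasList (1 + d + c + 1) (N.take i) μ ∧
      HasTally c d (N.take i) (G.votes D z) μ) (by norm_num)
    (fun i μ hI => ⟨hI.1.base.one, hI.1.length⟩) ?_ ?_ ?_).weaken (fun μ hI => ?_) le_rfl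
  · intro i μ k x hk hI
    exact ⟨hI.1.setReg (by omega), hI.2.1, hI.2.2⟩
  · rintro i hi μ ⟨hs, hl, ht⟩ h3
    rw [tallyBody, Prog.exec]
    set μ₁ := (Prog.seq (.load 9 (1 + d + c + 2) 3) (.const 15 0)).exec W μ with hμ₁
    have h1arr : μ₁.arr = μ.arr := by simp [hμ₁, Prog.exec]
    have h1reg : ∀ i, i ≠ 9 → i ≠ 15 → μ₁.reg i = μ.reg i := fun i h9 h15 => by
      simp [hμ₁, Prog.exec, h9, h15]
    have h19 : μ₁.reg 9 = N[i] := by simp [hμ₁, Prog.exec, h3, hs.list i hi]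
    have h115 : μ₁.reg 15 = 0 := by simp [hμ₁, Prog.exec]
    rw [Prog.exec]
    have hJ := exec_unroll (W := W) (f := tallyAt C D c) (m := c) (μ := μ₁) (J := fun k μ' =>
      μ'.arr = μ₁.arr ∧ (∀ i, i < 4 ∨ i = 9 ∨ i = 12 ∨ i = 13 → μ'.reg i = μ₁.reg i) ∧
        μ'.reg 15 = (Finset.univ.filter fun j : Fin c => (j : ℕ) < k ∧
          G.vote D z (G.nbrOfLeft N[i] j) = some N[i]).card) ?_ ?_
    · obtain ⟨h2arr, h2reg, h215⟩ := hJ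
      set μ₂ := (unroll (tallyAt C D c) c).exec W μ₁
      have hv : μ₂.reg 15 = G.votes D z N[i] := by
        rw [h215, G.votes_eq]
        congr 1
        ext j
        simp
      have h29 : μ₂.reg 9 = N[i] := (h2reg 9 (by simp)).trans h19
      have h23 : μ₂.reg 3 = i := (h2reg 3 (by simp)).trans ((h1reg 3 (by simp) (by simp)).trans h3)
      have harr : μ₂.arr = μ.arr := h2arr.trans h1arr
      have hs₂ : State G w z N (N.drop i) fuel μ₂ := hs.congr harr fun j hj => by
        rw [h2reg j (by omega), h1reg j (by omega) (by omega)]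
      have hl₂ : HasList (1 + d + c + 1) (N.take i) μ₂ := fun k hk => by rw [harr, hl k hk]
      have ht₂ : HasTally c d (N.take i) (G.votes D z) μ₂ := fun k hk => by rw [harr, ht k hk]
      have hdrop : N.drop i = N[i] :: N.drop (i + 1) := List.drop_eq_getElem_cons hi
      have htake : N.take (i + 1) = N.take i ++ [N[i]] := (List.take_concat_get' N i hi).symm
      have hilen : (N.take i).length = i := by simp; omega
      have hnotmem : N[i] ∉ N.drop (i + 1) := by
        have : (N.drop i).Nodup := hN.sublist (List.drop_sublist i N)
        rw [hdrop] at this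
        exact (List.nodup_cons.1 this).1
      have hexec : (Prog.seq (.seq (.store (1 + d + c + 4) 3 15) (.store (1 + d + c + 1) 3 9))
          (.seq (.const 10 0) (.store (1 + d + c + 3) 9 10))).exec W μ₂ =
          (((μ₂.setArr (1 + d + c + 4) i (G.votes D z N[i])).setArr (1 + d + c + 1) i
            (N[i] : ℕ)).setReg 10 0).setArr (1 + d + c + 3) (N[i] : ℕ) 0 := by
        simp only [Prog.exec, setArr_reg, setReg_reg, h23, h29, hv, Nat.zero_mod]
        norm_num
      rw [hexec, htake]
      rw [hdrop] at hs₂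
      refine ⟨⟨(((hs₂.setArr (Or.inr rfl)).setArr (Or.inl rfl)).setReg (by omega)).unmark hnotmem,
        ?_, ?_⟩, ?_⟩
      · have h' := HasList.append (μ := μ₂.setArr (1 + d + c + 4) i (G.votes D z N[i]))
          (a := 1 + d + c + 1) (l := N.take i) (v := N[i]) fun k hk => by
            rw [setArr_arr, if_neg (by omega), hl₂ k hk]
        rw [hilen] at h'
        intro k hk
        rw [setArr_arr, if_neg (by omega), setReg_arr, h' k hk]
      · have h' := ht₂.append (v := N[i])
        rw [hilen] at h'
        intro k hk
        rw [setArr_arr, if_neg (by omega), setReg_arr, setArr_arr, if_neg (by omega), h' k hk]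
      · simp [h23]
    · rintro k hk μ' ⟨e1, e2, e3⟩
      have hs₁ : State G w z N (N.drop i) fuel μ' := hs.congr (e1.trans h1arr) fun j hj => by
        rw [e2 j (by omega), h1reg j (by omega) (by omega)]
      have hcard : (Finset.univ.filter fun j : Fin c => (j : ℕ) < k ∧
          G.vote D z (G.nbrOfLeft N[i] j) = some N[i]).card ≤ c :=
        (Finset.card_le_univ _).trans_eq (Fintype.card_fin c)
      obtain ⟨a1, a2, a3⟩ := exec_tallyAt (W := W) C D (j := ⟨k, hk⟩) hW hs₁.base hs₁.word
        ((e2 9 (by simp)).trans h19) e3 (by omega)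
      refine ⟨a1.trans e1, fun j hj => (a2 j hj).trans (e2 j hj), ?_⟩
      rw [a3, card_filter_lt_succ hk]
    · exact ⟨rfl, fun _ _ => rfl, by simp [h115]⟩
  · refine ⟨by simpa using h, fun k hk => absurd hk (by simp), fun k hk => absurd hk (by simp)⟩
  · simpa using hI

/-- One random flip, for the list element whose index is in register `3`. -/
def flipBody (c d : ℕ) : Prog :=
  .seq (.seq (.load 9 (1 + d + c + 1) 3) (.const 16 0))
    (.seq (tosses c)
      (.seq (.seq (.load 15 (1 + d + c + 4) 3) (.op .lt 6 16 15))
        (.cond 6 (.seq (.seq (.load 10 (1 + d + c) 9) (.op .sub 10 2 10)) (.store (1 + d + c) 9 10))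
          .skip)))

/-- The `none` case is a default that a loop over the list does not reach. -/
def flipStep (s : ℕ) (m : Fin n → ℕ) (N : List (Fin n)) (i : ℕ) (z : Fin n → ZMod 2) :
    CoinTree (Fin n → ZMod 2) :=
  match N[i]? with
  | none => .leaf z
  | some v => (CoinTree.uniform s 0).bind fun k => .leaf (if k < m v then flipAt z v else z)

theorem iter_flipStep (s : ℕ) (m : Fin n → ℕ) (N l : List (Fin n)) (i : ℕ) (hl : N.drop i = l)
    (z : Fin n → ZMod 2) : iter (flipStep s m N) i l.length z = flips s m l z := by
  induction l generalizing i z with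
  | nil => rfl
  | cons v l ih =>
    have hv : N[i]? = some v := by rw [← List.head?_drop, hl]; rfl
    have hl' : N.drop (i + 1) = l := by rw [← List.tail_drop, hl]; rfl
    rw [List.length_cons, iter, flipStep, hv, flips, CoinTree.bind_assoc]
    congr 1
    funext k
    rw [CoinTree.bind, ih (i + 1) hl']

theorem impl_flips (hW : 1 < W) (hn : n < W) (hc : 2 ^ c ≤ W) (hN : N.length ≤ n) {m : Fin n → ℕ}
    (h : State G w z N [] fuel μ) (hl : HasList (1 + d + c + 1) N μ) (ht : HasTally c d N m μ) :
    Impl W (forLoop 12 (flipBody c d)) μ (N.length * (7 * c + 22) + 5)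
      (flips c m N z) fun z' μ' =>
        State G w z' N [] fuel μ' ∧ HasList (1 + d + c + 1) N μ' := by
  have hloop := Impl.forLoop (W := W) (μ := μ) (M := N.length) (N := 12) (body := flipBody c d)
    (k := 7 * c + 17) (by omega) hW (g := flipStep c m N)
    (I := fun _ z μ => State G w z N [] fuel μ ∧ HasList (1 + d + c + 1) N μ ∧ HasTally c d N m μ)
    (a := z) (by norm_num) (fun i z μ hI => ⟨hI.1.base.one, hI.1.length⟩) ?_ ?_ ⟨h, hl, ht⟩
  · rw [iter_flipStep c m N N 0 (by simp)] at hloop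
    exact hloop.weaken (fun z' μ' hI => ⟨hI.1, hI.2.1⟩) (by ring_nf; rfl)
  · intro i z μ k x hk hI
    exact ⟨hI.1.setReg (by omega), hI.2.1, hI.2.2⟩
  · rintro i hi z μ ⟨hs, hl, ht⟩ h3
    rw [flipStep, List.getElem?_eq_getElem hi]
    have hfirst : Ends W (.seq (.load 9 (1 + d + c + 1) 3) (.const 16 0)) μ 3 fun μ' =>
        (State G w z N [] fuel μ' ∧ μ'.arr = μ.arr) ∧ μ'.reg 3 = i ∧ μ'.reg 9 = N[i] ∧
          μ'.reg 16 = 0 := by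
      refine Ends.straight (p := .seq (.load 9 (1 + d + c + 1) 3) (.const 16 0)) ⟨trivial, trivial⟩
        ⟨⟨(hs.setReg (by omega)).setReg (by omega), rfl⟩, ?_, ?_, ?_⟩
      · simp [Prog.exec, h3]
      · simp [Prog.exec, h3, hl i hi]
      · simp [Prog.exec]
    refine (Ends.seq hfirst (k₂ := 7 * c + 13) fun μ₁ h₁ => ?_).weaken (fun _ _ h => h) (by omega)
    obtain ⟨⟨hs₁, harr₁⟩, h13, h19, h116⟩ := h₁
    have htoss := Impl.tosses (W := W) (μ := μ₁) (s := c) (by simpa [h116] using hc)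
    rw [h116] at htoss
    refine (Impl.seq htoss (k₂ := 11) fun k μ₂ h₂ => ?_).weaken (fun _ _ h => h) (by omega)
    obtain ⟨harr₂, h216, hreg₂⟩ := h₂
    have hs₂ : State G w z N [] fuel μ₂ := hs₁.congr harr₂ fun j hj =>
      hreg₂ j (by omega) (by omega)
    have h23 : μ₂.reg 3 = i := (hreg₂ 3 (by simp) (by simp)).trans h13
    have h29 : μ₂.reg 9 = N[i] := (hreg₂ 9 (by simp) (by simp)).trans h19
    have harr : μ₂.arr = μ.arr := harr₂.trans harr₁
    refine Impl.straight (p := .seq (.seq (.load 15 (1 + d + c + 4) 3) (.op .lt 6 16 15))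
        (.cond 6 (.seq (.seq (.load 10 (1 + d + c) 9) (.op .sub 10 2 10)) (.store (1 + d + c) 9 10))
          .skip)) (by simp [Prog.Straight]) ?_
    rw [Prog.exec]
    set μ₃ := (Prog.seq (.load 15 (1 + d + c + 4) 3) (.op .lt 6 16 15)).exec W μ₂ with hμ₃
    have h36 : μ₃.reg 6 = if k < m N[i] then 1 else 0 := by
      have hif : ∀ p : Prop, [Decidable p] → (if p then 1 else 0) % W = if p then 1 else 0 :=
        fun p _ => Nat.mod_eq_of_lt (by split_ifs <;> omega)
      simp [hμ₃, Prog.exec, Op.eval, h23, h216, harr, ht i hi, hif]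
    have hs₃ : State G w z N [] fuel μ₃ := (hs₂.setReg (by omega)).setReg (by omega)
    have harr₃ : μ₃.arr = μ.arr := harr
    have h33 : μ₃.reg 3 = i := by simp [hμ₃, Prog.exec, h23]
    have h39 : μ₃.reg 9 = N[i] := by simp [hμ₃, Prog.exec, h29]
    rw [Prog.exec]
    by_cases hk : k < m N[i]
    · rw [if_pos hk] at h36
      rw [h36, if_pos one_ne_zero, if_pos hk]
      have hbit : (1 - (z N[i]).val) % W = 1 - (z N[i]).val := Nat.mod_eq_of_lt (by omega)
      have hexec : (Prog.seq (.seq (.load 10 (1 + d + c) 9) (.op .sub 10 2 10))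
          (.store (1 + d + c) 9 10)).exec W μ₃ =
          ((μ₃.setReg 10 (z N[i]).val).setReg 10 (1 - (z N[i]).val)).setArr (1 + d + c) (N[i] : ℕ)
            (1 - (z N[i]).val) := by
        simp [Prog.exec, Op.eval, h39, hs₃.word N[i], hs₃.base.one, hbit]
      rw [hexec]
      refine ⟨⟨((hs₃.setReg (by omega)).setReg (by omega)).flipAt _, ?_, ?_⟩, ?_⟩
      · intro j hj
        rw [setArr_arr, if_neg (by omega), setReg_arr, setReg_arr, harr₃, hl j hj]
      · intro j hj
        rw [setArr_arr, if_neg (by omega), setReg_arr, setReg_arr, harr₃, ht j hj]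
      · simp [h33]
    · rw [if_neg hk] at h36
      rw [h36, if_neg (not_not.2 rfl), if_neg hk]
      exact ⟨⟨hs₃, fun j hj => (congrFun (congrFun harr₃ _) _).trans (hl j hj),
        fun j hj => (congrFun (congrFun harr₃ _) _).trans (ht j hj)⟩, h33⟩

/-- Register `14` tells whether another round is due. -/
def setGo : Prog := .cond 11 (.copy 14 13) (.const 14 0)

noncomputable def round (c : ℕ) : Prog :=
  .seq (gather C D c) (.seq (tally C D c) (.seq (forLoop 12 (flipBody c d))
    (.seq (.seq (.copy 11 12) (.op .sub 13 13 12)) setGo)))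

/-- What the memory contains between two rounds. -/
structure RoundInv (G : RegularBipartiteGraph c d n r) (w z : Fin n → ZMod 2) (L : List (Fin n))
    (fuel : ℕ) (μ : Memory) : Prop where
  state : ∃ N, State G w z N [] fuel μ
  list : HasList (1 + d + c + 1) L μ
  length : μ.reg 11 = L.length
  go : μ.reg 14 = if L.length ≠ 0 then fuel else 0

/-- A bound for the time per element of the lists in a round. -/
noncomputable def roundCost (c : ℕ) : ℕ :=
  (gatherBody C D c).size + (tallyBody C D c).size + 7 * c + 72

/-- The `- 1` leaves a unit for the test of the enclosing loop; fixed overheads fit into `roundCost`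
because `L` is nonempty. -/
theorem impl_round (hW : 1 < W) (hn : n < W) (hc : c + 1 < W) (hcW : 2 ^ c ≤ W) (hfuel : fuel < W)
    (hL : L.length ≤ n) (hL0 : L.length ≠ 0) (h : RoundInv G w z L fuel μ) :
    Impl W (round C D c) μ (roundCost C D c * (L.length + (G.collect D z L).length) - 1)
      (flips c (G.votes D z) (G.collect D z L) z) fun z' =>
        RoundInv G w z' (G.collect D z L) (fuel - (G.collect D z L).length) := by
  obtain ⟨⟨N₀, hs⟩, hl, h11, -⟩ := h
  set N := G.collect D z L with hNdef
  have hNn : N.length ≤ n := G.length_collect_le z L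
  refine (Ends.seq (ends_gather C D hW hn (by omega) hs hl h11)
    (k₂ := N.length * ((tallyBody C D c).size + 5) + 5 + (N.length * (7 * c + 22) + 5 + 7 + 1) + 1)
    fun μ₁ h₁ => ?_).weaken (fun _ _ h => h) ?_
  · refine Ends.seq (ends_tally C D hW hn hc (G.nodup_collect z L) h₁) fun μ₂ h₂ => ?_
    refine Impl.seq_ends (k₁ := N.length * (7 * c + 22) + 5) (k₂ := 7) (impl_flips hW hn hcW hNn h₂.1 h₂.2.1 h₂.2.2) fun z' μ₃ h₃ => ?_
    refine Ends.straight (p := .seq (.seq (.copy 11 12) (.op .sub 13 13 12)) setGo)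
      (by simp [Prog.Straight, setGo]) ?_
    obtain ⟨hs₃, hl₃⟩ := h₃
    rw [Prog.exec]
    set μ₄ := (Prog.seq (.copy 11 12) (.op .sub 13 13 12)).exec W μ₃ with hμ₄
    have hf : (fuel - N.length) % W = fuel - N.length := Nat.mod_eq_of_lt (by omega)
    have h411 : μ₄.reg 11 = N.length := by simp [hμ₄, Prog.exec, hs₃.length]
    have h413 : μ₄.reg 13 = fuel - N.length := by
      simp [hμ₄, Prog.exec, Op.eval, hs₃.length, hs₃.fuel_eq, hf]
    have harr : μ₄.arr = μ₃.arr := rfl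
    have hreg : ∀ i, i ≠ 11 → i ≠ 13 → μ₄.reg i = μ₃.reg i := fun i hi hi' => by
      simp [hμ₄, Prog.exec, hi, hi']
    have hs₄ : State G w z' N [] (fuel - N.length) μ₄ :=
      ⟨hs₃.base.congr (fun i hi => hreg i (by omega) (by omega)) fun _ _ _ _ => rfl, hs₃.input,
        hs₃.word, hs₃.list, (hreg 12 (by simp) (by simp)).trans hs₃.length, hs₃.mark, h413⟩
    rw [setGo, Prog.exec]
    split_ifs with hgo
    · exact ⟨⟨N, hs₄.setReg (by omega)⟩, hl₃, by simp [Prog.exec, h411], by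
        rw [h411] at hgo
        rw [if_pos hgo]
        simp [Prog.exec, h413]⟩
    · exact ⟨⟨N, hs₄.setReg (by omega)⟩, hl₃, by simp [Prog.exec, h411], by
        rw [h411] at hgo
        simp [Prog.exec, not_not.1 hgo]⟩
  · rw [roundCost]
    have e1 : 1 ≤ L.length := Nat.one_le_iff_ne_zero.2 hL0
    generalize (gatherBody C D c).size = a
    generalize (tallyBody C D c).size = b
    generalize N.length = k at *
    generalize L.length = l at *
    refine Nat.le_sub_of_add_le ?_
    nlinarith [Nat.zero_le (a * k), Nat.zero_le (b * l), Nat.zero_le (c * l)]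

/-- Amortization: a list is paid for twice, as the new list of a round and as the old list of the
next, and both payments are charged to the fuel it uses. Only the last list can exceed the remaining
fuel, and it has at most `n` entries. -/
theorem impl_rounds (hW : 1 < W) (hn : n < W) (hc : c + 1 < W) (hcW : 2 ^ c ≤ W) (g : ℕ)
    (hfuel : fuel < W) (hg : fuel < g) (hL : L.length ≤ n) (h : RoundInv G w z L fuel μ) :
    Impl W (.loop 14 (round C D c)) μ (roundCost C D c * (2 * fuel + L.length + n) + 1)
      (G.rounds D g fuel L z) fun z' μ' =>
        Base G μ' ∧ HasWord 0 w μ' ∧ HasWord (1 + d + c) z' μ' := by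
  have last_round : ∀ (g fuel : ℕ) (L : List (Fin n)) (z : Fin n → ZMod 2) (μ : Memory),
      RoundInv G w z L fuel μ → L.length = 0 ∨ fuel = 0 →
      Impl W (.loop 14 (round C D c)) μ 1 (G.rounds D g fuel L z) fun z' μ' =>
        Base G μ' ∧ HasWord 0 w μ' ∧ HasWord (1 + d + c) z' μ' := by
    intro g fuel L z μ h hend
    have h14 : μ.reg 14 = 0 := by
      rw [h.go]
      rcases hend with e | e <;> simp [e]
    have hr : G.rounds D g fuel L z = .leaf z := by
      rcases g with _ | g
      · rfl
      · rw [rounds, if_pos hend]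
    obtain ⟨N, hs⟩ := h.state
    rw [hr]
    exact Impl.loop_zero h14 ⟨hs.base, hs.input, hs.word⟩
  induction g generalizing fuel L z μ with
  | zero => omega
  | succ g ih =>
    by_cases hend : L.length = 0 ∨ fuel = 0
    · exact (last_round _ _ _ _ _ h hend).weaken (fun _ _ h => h) (by omega)
    · rw [rounds, if_neg hend]
      push Not at hend
      have h14 : μ.reg 14 ≠ 0 := by
        rw [h.go, if_pos hend.1]
        exact hend.2
      have hround := impl_round C D hW hn hc hcW hfuel hL hend.1 h
      set N := G.collect D z L with hNdef
      have hNn : N.length ≤ n := G.length_collect_le z L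
      have hcost : 1 ≤ roundCost C D c * (L.length + N.length) :=
        Nat.mul_pos (by rw [roundCost]; omega) (by omega)
      by_cases hend' : N.length = 0 ∨ fuel - N.length = 0
      · refine (Impl.loop_ne_zero h14 hround fun z' μ' h' => last_round g _ _ z' μ' h' hend').weaken
          (fun _ _ h => h) ?_
        have : roundCost C D c * (L.length + N.length) ≤
            roundCost C D c * (2 * fuel + L.length + n) := Nat.mul_le_mul_left _ (by omega)
        omega
      · push Not at hend'
        refine (Impl.loop_ne_zero h14 hround fun z' μ' h' =>
          ih (by omega) (by omega) hNn h').weaken (fun _ _ h => h) ?_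
        have : roundCost C D c * (L.length + N.length) +
            roundCost C D c * (2 * (fuel - N.length) + N.length + n) ≤
            roundCost C D c * (2 * fuel + L.length + n) := by
          rw [← Nat.mul_add]
          exact Nat.mul_le_mul_left _ (by omega)
        omega

end RandRAM

/-! ### Initialization, acceptance test and the complete decoder -/

namespace RandRAM

open RegularBipartiteGraph

variable {c d n r W : ℕ} {G : RegularBipartiteGraph c d n r} {μ μ' : Memory}
  (C : Submodule (ZMod 2) (Fin d → ZMod 2)) (D : (Fin d → ZMod 2) → Option (Fin d))
  {w z : Fin n → ZMod 2} {N M L : List (Fin n)} {fuel F : ℕ}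

def initBody (c d : ℕ) : Prog :=
  .seq (.seq (.load 6 0 3) (.store (1 + d + c) 3 6))
    (.seq (.store (1 + d + c + 1) 3 3) (.store (1 + d + c + 3) 3 10))

/-- The received word is copied, and the first round is prepared, with fuel `F * n`. -/
def init (c d F : ℕ) : Prog :=
  .seq (.seq (.const 10 0) (.const 12 0)) (.seq (forLoop 0 (initBody c d))
    (.seq (.seq (.copy 11 0) (.seq (.const 6 F) (.op .mul 13 6 0))) setGo))

/-- Nothing is assumed about the working arrays, so an attempt can start from whatever the previous
one left behind. -/
theorem ends_init (hW : 1 < W) (hn : n < W) (hF : F < W) (hFn : F * n < W) (hb : Base G μ)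
    (hw : HasWord 0 w μ) :
    Ends W (init c d F) μ (n * 12 + 19) (RoundInv G w w (List.finRange n) (F * n)) := by
  refine (Ends.seq (k₁ := 3) (k₂ := n * 12 + 15) (Q := fun μ' => (Base G μ' ∧ HasWord 0 w μ') ∧
    μ'.reg 10 = 0 ∧ μ'.reg 12 = 0) (Ends.straight (p := .seq (.const 10 0) (.const 12 0))
      ⟨trivial, trivial⟩ ?_) fun μ₁ h₁ => ?_).weaken (fun _ _ h => h) (by omega)
  · exact ⟨⟨(hb.setReg (by omega)).setReg (by omega), hw⟩, by simp [Prog.exec], by simp [Prog.exec]⟩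
  refine Ends.seq (k₁ := n * 12 + 5) (k₂ := 9) ((Ends.forLoop (W := W) (μ := μ₁) (M := n) hn hW
    (body := initBody c d)
    ⟨⟨trivial, trivial⟩, trivial, trivial⟩ (I := fun i μ => (Base G μ ∧ HasWord 0 w μ) ∧
      (μ.reg 10 = 0 ∧ μ.reg 12 = 0) ∧ ∀ v : Fin n, (v : ℕ) < i →
        μ.arr (1 + d + c) v = (w v).val ∧ μ.arr (1 + d + c + 1) v = v ∧
        μ.arr (1 + d + c + 3) v = 0) (by norm_num)
    (fun i μ hI => ⟨hI.1.1.one, hI.1.1.left_size⟩) ?_ ?_ ?_).weaken (fun μ hI => hI)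
      le_rfl) fun μ₂ h₂ => ?_
  · rintro i μ k x hk ⟨⟨hI1, hI2⟩, ⟨hI3, hI4⟩, hI5⟩
    exact ⟨⟨hI1.setReg (by omega), hI2⟩, ⟨by rw [setReg_reg, if_neg (by omega), hI3],
      by rw [setReg_reg, if_neg (by omega), hI4]⟩, hI5⟩
  · rintro i hi μ ⟨⟨hI1, hI2⟩, ⟨hI3, hI4⟩, hI5⟩ h3
    have hexec : (initBody c d).exec W μ = (((μ.setReg 6 (w ⟨i, hi⟩).val).setArr (1 + d + c) i
        (w ⟨i, hi⟩).val).setArr (1 + d + c + 1) i i).setArr (1 + d + c + 3) i 0 := by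
      have := hI2 ⟨i, hi⟩
      simp only at this
      simp [initBody, Prog.exec, h3, hI3, this]
    rw [hexec]
    refine ⟨⟨⟨(((hI1.setReg (by omega)).setArr (by omega)).setArr (by omega)).setArr (by omega),
      fun v => ?_⟩, ⟨by simp [hI3], by simp [hI4]⟩, fun v hv => ?_⟩, by simp [h3]⟩
    · simp only [setArr_arr, setReg_arr]
      rw [if_neg (by omega), if_neg (by omega), if_neg (by omega), hI2]
    · simp only [setArr_arr, setReg_arr]
      rcases Nat.lt_succ_iff_lt_or_eq.1 hv with hv | hv
      · have := hI5 v hv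
        simp [hv.ne, this]
      · obtain rfl : v = ⟨i, hi⟩ := Fin.ext hv
        simp
  · exact ⟨h₁.1, h₁.2, fun v hv => absurd hv (by omega)⟩
  · obtain ⟨⟨hI1, hI2⟩, ⟨hI3, hI4⟩, hI5⟩ := h₂
    refine Ends.straight (p := .seq (.seq (.copy 11 0) (.seq (.const 6 F) (.op .mul 13 6 0))) setGo)
      (by simp [Prog.Straight, setGo]) ?_
    rw [Prog.exec]
    set μ₃ := (Prog.seq (.copy 11 0) (.seq (.const 6 F) (.op .mul 13 6 0))).exec W μ₂ with hμ₃
    have h11 : μ₃.reg 11 = n := by simp [hμ₃, Prog.exec, hI1.left_size]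
    have h13 : μ₃.reg 13 = F * n := by
      simp [hμ₃, Prog.exec, Op.eval, hI1.left_size, Nat.mod_eq_of_lt hF, Nat.mod_eq_of_lt hFn]
    have hreg : ∀ i, i ≠ 11 → i ≠ 6 → i ≠ 13 → μ₃.reg i = μ₂.reg i := fun i h1 h2 h3 => by
      simp [hμ₃, Prog.exec, h1, h2, h3]
    have harr : μ₃.arr = μ₂.arr := rfl
    have hs : State G w w [] [] (F * n) μ₃ :=
      ⟨hI1.congr (fun i hi => hreg i (by omega) (by omega) (by omega)) fun _ _ _ _ => rfl, hI2,
        fun v => by rw [harr]; exact (hI5 v v.2).1, fun i hi => absurd hi (by simp),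
        (hreg 12 (by simp) (by simp) (by simp)).trans hI4,
        fun v => by rw [harr, (hI5 v v.2).2.2]; simp, h13⟩
    have hl : HasList (1 + d + c + 1) (List.finRange n) μ₃ := by
      intro i hi
      rw [List.length_finRange] at hi
      rw [harr, (hI5 ⟨i, hi⟩ hi).2.1]
      simp
    rw [setGo, Prog.exec]
    split_ifs with hgo
    · exact ⟨⟨[], hs.setReg (by omega)⟩, hl, by simp [Prog.exec, h11], by
        rw [h11] at hgo
        simp [Prog.exec, h13, hgo]⟩
    · exact ⟨⟨[], hs.setReg (by omega)⟩, hl, by simp [Prog.exec, h11], by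
        rw [h11] at hgo
        simp [Prog.exec, not_not.1 hgo]⟩

/-- Two bits differ exactly when one is strictly below the other, so the two comparisons add up to
the contribution to the distance. -/
def distBody (c d : ℕ) : Prog :=
  .seq (.seq (.load 6 0 3) (.load 10 (1 + d + c) 3))
    (.seq (.seq (.op .lt 15 6 10) (.op .lt 16 10 6)) (.seq (.op .add 15 15 16) (.op .add 18 18 15)))

noncomputable def codeBody (c : ℕ) : Prog :=
  .seq (.seq (.copy 5 3) (inspect C D (1 + d + c) d 0)) (.cond 19 .skip (.const 17 0))

/-- The relative distance is compared with `p / q` after clearing denominators. -/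
def judge (p q : ℕ) : Prog :=
  .seq (.seq (.const 6 q) (.op .mul 6 6 18)) (.seq (.seq (.const 10 p) (.op .mul 10 10 0))
    (.seq (.op .lt 6 10 6) (.cond 6 (.const 17 0) .skip)))

/-- Register `17` tells whether the current word is accepted. -/
noncomputable def check (c p q : ℕ) : Prog :=
  .seq (.seq (.const 17 1) (.const 18 0)) (.seq (forLoop 0 (distBody c d))
    (.seq (forLoop 1 (codeBody C D c)) (judge p q)))

/-- The graph, the received word and the current word. -/
def HasWords (G : RegularBipartiteGraph c d n r) (w z : Fin n → ZMod 2) (μ : Memory) : Prop :=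
  Base G μ ∧ HasWord 0 w μ ∧ HasWord (1 + d + c) z μ

theorem HasWords.congr (h : HasWords G w z μ) (harr : μ'.arr = μ.arr)
    (hreg : ∀ i < 3, μ'.reg i = μ.reg i) : HasWords G w z μ' :=
  ⟨h.1.congr hreg fun _ _ _ _ => by rw [harr], fun v => by rw [harr, h.2.1],
    fun v => by rw [harr, h.2.2]⟩

theorem HasWords.setReg (h : HasWords G w z μ) {i x : ℕ} (hi : 3 ≤ i) :
    HasWords G w z (μ.setReg i x) :=
  ⟨h.1.setReg hi, h.2⟩

theorem ends_dist (hW : 1 < W) (hn : n < W) (h : HasWords G w z μ) (h17 : μ.reg 17 = 1)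
    (h18 : μ.reg 18 = 0) :
    Ends W (forLoop 0 (distBody c d)) μ (n * 16 + 5) fun μ' => HasWords G w z μ' ∧
      μ'.reg 17 = 1 ∧ μ'.reg 18 = hammingDist w z := by
  refine (Ends.forLoop (W := W) (μ := μ) (M := n) hn hW (body := distBody c d)
    (by simp [distBody, Prog.Straight]) (I := fun i μ => HasWords G w z μ ∧ μ.reg 17 = 1 ∧
      μ.reg 18 = (Finset.univ.filter fun v : Fin n => (v : ℕ) < i ∧ w v ≠ z v).card) (by norm_num)
    (fun i μ hI => ⟨hI.1.1.one, hI.1.1.left_size⟩) ?_ ?_ ?_).weaken (fun μ hI => ?_) le_rfl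
  · rintro i μ k x hk ⟨hI1, hI2, hI3⟩
    exact ⟨hI1.setReg (by omega), by rw [setReg_reg, if_neg (by omega), hI2],
      by rw [setReg_reg, if_neg (by omega), hI3]⟩
  · rintro i hi μ ⟨hI1, hI2, hI3⟩ h3
    refine ⟨⟨hI1.congr rfl fun j hj => ?_, ?_, ?_⟩, ?_⟩
    · have e : ∀ k, 3 ≤ k → j ≠ k := fun k hk => by omega
      simp [distBody, Prog.exec, e]
    · simp [distBody, Prog.exec, hI2]
    · rw [card_filter_lt_succ hi]
      have hcard : (Finset.univ.filter fun v : Fin n => (v : ℕ) < i ∧ w v ≠ z v).card ≤ i := by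
        calc _ ≤ ((Finset.range i).card) := by
              refine Finset.card_le_card_of_injOn (fun v => (v : ℕ)) (fun v hv => ?_)
                (fun a _ b _ hab => Fin.ext hab)
              simp only [Finset.coe_filter, Finset.mem_univ, true_and, Set.mem_ofPred_eq] at hv
              simpa using hv.1
          _ = i := Finset.card_range i
      generalize (Finset.univ.filter fun v : Fin n => (v : ℕ) < i ∧ w v ≠ z v).card = k at *
      have hk0 : k % W = k := Nat.mod_eq_of_lt (by omega)
      have hk1 : (k + 1) % W = k + 1 := Nat.mod_eq_of_lt (by omega)
      have ha := hI1.2.1 ⟨i, hi⟩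
      have hb := hI1.2.2 ⟨i, hi⟩
      simp only at ha hb
      have hbits : ∀ a b : ZMod 2, (a = b ∧ a.val = b.val) ∨ (a ≠ b ∧ a.val = 0 ∧ b.val = 1) ∨
          (a ≠ b ∧ a.val = 1 ∧ b.val = 0) := by decide
      rcases hbits (w ⟨i, hi⟩) (z ⟨i, hi⟩) with ⟨e1, e2⟩ | ⟨e1, e2, e3⟩ | ⟨e1, e2, e3⟩
      · simp [distBody, Prog.exec, Op.eval, h3, ha, hb, e1, hI3, hk0]
      · simp [distBody, Prog.exec, Op.eval, h3, ha, hb, e1, e2, e3, hI3, hk1, Nat.mod_eq_of_lt hW]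
      · simp [distBody, Prog.exec, Op.eval, h3, ha, hb, e1, e2, e3, hI3, hk1, Nat.mod_eq_of_lt hW]
    · simp [distBody, Prog.exec, h3]
  · exact ⟨h, h17, by simp [h18]⟩
  · refine ⟨hI.1, hI.2.1, hI.2.2.trans ?_⟩
    rw [hammingDist]
    congr 1
    ext v
    simp

open Classical in
theorem ends_code (hW : 1 < W) (hr : r < W) (h : HasWords G w z μ) (h17 : μ.reg 17 = 1)
    (h18 : μ.reg 18 = hammingDist w z) :
    Ends W (forLoop 1 (codeBody C D c)) μ (r * ((codeBody C D c).size + 5) + 5) fun μ' =>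
      HasWords G w z μ' ∧ μ'.reg 18 = hammingDist w z ∧
        μ'.reg 17 = if z ∈ G.tannerCode C then 1 else 0 := by
  refine (Ends.forLoop (W := W) (μ := μ) (M := r) hr hW (body := codeBody C D c)
    (by simp [codeBody, Prog.Straight, straight_inspect]) (I := fun i μ => HasWords G w z μ ∧
      μ.reg 18 = hammingDist w z ∧
      μ.reg 17 = if ∀ u : Fin r, (u : ℕ) < i → G.view z u ∈ C then 1 else 0) (by norm_num)
    (fun i μ hI => ⟨hI.1.1.one, hI.1.1.right_size⟩) ?_ ?_ ?_).weaken (fun μ hI => ?_) le_rfl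
  · rintro i μ k x hk ⟨hI1, hI2, hI3⟩
    exact ⟨hI1.setReg (by omega), by rw [setReg_reg, if_neg (by omega), hI2],
      by rw [setReg_reg, if_neg (by omega), hI3]⟩
  · rintro i hi μ ⟨hI1, hI2, hI3⟩ h3
    have hins := inspected (W := W) C D (a := 1 + d + c) (z := z) (u := ⟨i, hi⟩)
      (μ := μ.setReg 5 i) hW (hI1.1.setReg (by omega)) hI1.2.2 (by simp)
    have hexec : (codeBody C D c).exec W μ = (Prog.cond 19 .skip (.const 17 0)).exec W
        ((inspect C D (1 + d + c) d 0).exec W (μ.setReg 5 i)) := by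
      rw [codeBody, Prog.exec, Prog.exec, Prog.exec, h3]
    rw [hexec, Prog.exec]
    set μ₁ := (inspect C D (1 + d + c) d 0).exec W (μ.setReg 5 i)
    have harr : μ₁.arr = μ.arr := hins.arr
    have hreg : ∀ i, i ≠ 5 → i ≠ 6 → i ≠ 7 → i ≠ 8 → i ≠ 19 → μ₁.reg i = μ.reg i :=
      fun i h5 h6 h7 h8 h19 => (hins.reg i h6 h7 h8 h19).trans (by simp [h5])
    have hw₁ : HasWords G w z μ₁ := hI1.congr harr fun j hj =>
      hreg j (by omega) (by omega) (by omega) (by omega) (by omega)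
    have h3' : μ₁.reg 3 = i := (hreg 3 (by simp) (by simp) (by simp) (by simp) (by simp)).trans h3
    have h18' : μ₁.reg 18 = hammingDist w z :=
      (hreg 18 (by simp) (by simp) (by simp) (by simp) (by simp)).trans hI2
    have h17' : μ₁.reg 17 = if ∀ u : Fin r, (u : ℕ) < i → G.view z u ∈ C then 1 else 0 :=
      (hreg 17 (by simp) (by simp) (by simp) (by simp) (by simp)).trans hI3
    by_cases hC : G.view z ⟨i, hi⟩ ∈ C
    · have h19 : μ₁.reg 19 = 1 := by rw [hins.code, if_pos hC]
      rw [if_pos (by rw [h19]; exact one_ne_zero)]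
      refine ⟨⟨hw₁, h18', h17'.trans ?_⟩, h3'⟩
      congr 1
      refine propext ⟨fun hall u hu => ?_, fun hall u hu => hall u (by omega)⟩
      rcases Nat.lt_succ_iff_lt_or_eq.1 hu with hu | hu
      · exact hall u hu
      · obtain rfl : u = ⟨i, hi⟩ := Fin.ext hu
        exact hC
    · have h19 : μ₁.reg 19 = 0 := by rw [hins.code, if_neg hC]
      rw [if_neg (by rw [h19]; simp)]
      refine ⟨⟨hw₁.setReg (by omega), by simp [Prog.exec, h18'], ?_⟩, by simp [Prog.exec, h3']⟩
      rw [if_neg fun hall => hC (hall _ (by simp))]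
      simp [Prog.exec]
  · exact ⟨h, h18, by simp [h17]⟩
  · refine ⟨hI.1, hI.2.1, hI.2.2.trans ?_⟩
    congr 1
    exact propext ⟨fun hall u => hall u u.2, fun hall u _ => hall u⟩

open Classical in
theorem ends_check {p q : ℕ} (hW : 1 < W) (hn : n < W) (hr : r < W) (hp : p < W) (hq : q < W)
    (hpn : p * n < W) (hqn : q * n < W) (h : HasWords G w z μ) :
    Ends W (check C D c p q) μ (n * 16 + r * ((codeBody C D c).size + 5) + 30) fun μ' =>
      HasWords G w z μ' ∧ μ'.reg 17 = if G.Accepts C p q w z then 1 else 0 := by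
  refine (Ends.seq (k₁ := 3) (k₂ := n * 16 + 5 + (r * ((codeBody C D c).size + 5) + 5 + 13 + 1) + 1)
    (Q := fun μ' => HasWords G w z μ' ∧ μ'.reg 17 = 1 ∧ μ'.reg 18 = 0)
    (Ends.straight (p := .seq (.const 17 1) (.const 18 0)) ⟨trivial, trivial⟩ ?_)
    fun μ₁ h₁ => Ends.seq (k₁ := n * 16 + 5) (k₂ := r * ((codeBody C D c).size + 5) + 5 + 13 + 1)
      (ends_dist hW hn h₁.1 h₁.2.1 h₁.2.2) fun μ₂ h₂ =>
        Ends.seq (k₁ := r * ((codeBody C D c).size + 5) + 5) (k₂ := 13)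
          (ends_code C D hW hr h₂.1 h₂.2.1 h₂.2.2)
          fun μ₃ h₃ => Ends.straight (p := judge p q) (by simp [judge, Prog.Straight]) ?_).weaken
            (fun _ _ h => h) (by omega)
  · exact ⟨(h.setReg (by omega)).setReg (by omega), by simp [Prog.exec, Nat.mod_eq_of_lt hW],
      by simp [Prog.exec]⟩
  · obtain ⟨hw₃, h18, h17⟩ := h₃
    have hd : hammingDist w z ≤ n := hammingDist_le_card_fintype.trans_eq (Fintype.card_fin n)
    have hqd : q * hammingDist w z < W := lt_of_le_of_lt (Nat.mul_le_mul_left q hd) hqn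
    rw [judge, Prog.exec, Prog.exec, Prog.exec]
    set μ₄ := (Prog.seq (.const 10 p) (.op .mul 10 10 0)).exec W
      ((Prog.seq (.const 6 q) (.op .mul 6 6 18)).exec W μ₃) with hμ₄
    have h6 : μ₄.reg 6 = q * hammingDist w z := by
      simp [hμ₄, Prog.exec, Op.eval, h18, Nat.mod_eq_of_lt hq, Nat.mod_eq_of_lt hqd]
    have h10 : μ₄.reg 10 = p * n := by
      simp [hμ₄, Prog.exec, Op.eval, hw₃.1.left_size, Nat.mod_eq_of_lt hp, Nat.mod_eq_of_lt hpn]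
    have h17' : μ₄.reg 17 = if z ∈ G.tannerCode C then 1 else 0 := by
      simp [hμ₄, Prog.exec, h17]
    have hw₄ : HasWords G w z μ₄ := hw₃.congr rfl fun j hj => by
      have e : ∀ k, 3 ≤ k → j ≠ k := fun k hk => by omega
      simp [hμ₄, Prog.exec, e]
    by_cases hlt : p * n < q * hammingDist w z
    · have hacc : ¬ G.Accepts C p q w z := fun h => absurd h.2 (not_le.2 hlt)
      rw [if_neg hacc]
      simp only [Prog.exec, Op.eval, h6, h10, hlt, if_true, setReg_reg, Nat.mod_eq_of_lt hW, ne_eq,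
        one_ne_zero, not_false_eq_true]
      exact ⟨(hw₄.setReg (by omega)).setReg (by omega), by simp⟩
    · simp only [Prog.exec, Op.eval, h6, h10, hlt, if_false, setReg_reg, ne_eq, if_true,
        Nat.zero_mod, not_true]
      refine ⟨hw₄.setReg (by omega), ?_⟩
      rw [if_neg (by norm_num), h17']
      congr 1
      exact propext ⟨fun h => ⟨h, not_lt.1 hlt⟩, fun h => h.1⟩

/-- An accepted word replaces the received word. -/
def write (c d : ℕ) : Prog :=
  forLoop 0 (.cond 17 (.seq (.load 6 (1 + d + c) 3) (.store 0 3 6)) .skip)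

theorem ends_write (hW : 1 < W) (hn : n < W) (P : Prop) [Decidable P] (h : HasWords G w z μ)
    (h17 : μ.reg 17 = if P then 1 else 0) :
    Ends W (write c d) μ (n * 10 + 5) fun μ' =>
      Base G μ' ∧ HasWord 0 (if P then z else w) μ' := by
  refine (Ends.forLoop (W := W) (μ := μ) (M := n) hn hW
    (body := .cond 17 (.seq (.load 6 (1 + d + c) 3) (.store 0 3 6)) .skip)
    (by simp [Prog.Straight]) (I := fun i μ => Base G μ ∧ HasWord (1 + d + c) z μ ∧
      μ.reg 17 = (if P then 1 else 0) ∧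
      HasWord 0 (fun v => if (v : ℕ) < i ∧ P then z v else w v) μ) (by norm_num)
    (fun i μ hI => ⟨hI.1.one, hI.1.left_size⟩) ?_ ?_ ?_).weaken (fun μ hI => ?_) le_rfl
  · rintro i μ k x hk ⟨hI1, hI2, hI3, hI4⟩
    exact ⟨hI1.setReg (by omega), hI2, by rw [setReg_reg, if_neg (by omega), hI3], hI4⟩
  · rintro i hi μ ⟨hI1, hI2, hI3, hI4⟩ h3
    rw [Prog.exec, hI3]
    by_cases hP : P
    · rw [if_pos hP, if_pos one_ne_zero]
      have hz := hI2 ⟨i, hi⟩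
      simp only at hz
      have hexec : (Prog.seq (.load 6 (1 + d + c) 3) (.store 0 3 6)).exec W μ =
          (μ.setReg 6 (z ⟨i, hi⟩).val).setArr 0 i (z ⟨i, hi⟩).val := by
        simp [Prog.exec, h3, hz]
      rw [hexec]
      refine ⟨⟨(hI1.setReg (by omega)).setArr (Or.inl rfl), fun v => ?_, ?_, fun v => ?_⟩, ?_⟩
      · rw [setArr_arr, if_neg (by omega), setReg_arr, hI2]
      · simp [hI3, hP]
      · rw [setArr_arr, setReg_arr, hI4]
        by_cases hv : (v : ℕ) = i
        · obtain rfl : v = ⟨i, hi⟩ := Fin.ext hv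
          simp [hP]
        · have : (v : ℕ) < i + 1 ↔ (v : ℕ) < i := by omega
          simp [hv, this]
      · simp [h3]
    · rw [if_neg hP, if_neg (not_not.2 rfl)]
      refine ⟨⟨hI1, hI2, by rw [Prog.exec, hI3, if_neg hP]; all_goals simp, fun v => ?_⟩, h3⟩
      have := hI4 v
      simp only [hP, and_false, if_false] at this ⊢
      exact this
  · exact ⟨h.1, h.2.2, h17, fun v => by simp [h.2.1 v]⟩
  · refine ⟨hI.1, fun v => ?_⟩
    rw [hI.2.2.2 v]
    by_cases hP : P <;> simp [hP]

noncomputable def attemptProg (c F p q : ℕ) : Prog :=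
  .seq (init c d F) (.seq (.loop 14 (round C D c)) (.seq (check C D c p q) (write c d)))

theorem impl_attempt {p q : ℕ} (hW : 1 < W) (hn : n < W) (hc : c + 1 < W) (hcW : 2 ^ c ≤ W)
    (hF : F < W) (hFn : F * n < W) (hr : r < W) (hp : p < W) (hq : q < W)
    (hpn : p * n < W) (hqn : q * n < W) (hb : Base G μ) (hw : HasWord 0 w μ) :
    Impl W (attemptProg C D c F p q) μ (n * 38 + r * ((codeBody C D c).size + 5) + 63 +
      roundCost C D c * (2 * (F * n) + n + n)) (G.attempt D C p q (F * n) w) fun w' μ' =>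
        Base G μ' ∧ HasWord 0 w' μ' := by
  classical
  refine (Ends.seq (ends_init hW hn hF hFn hb hw) fun μ₁ h₁ => Impl.weaken (k₁ := _)
    (Impl.map (Impl.seq_ends (Q' := fun z μ' => Base G μ' ∧
      HasWord 0 (if G.Accepts C p q w z then z else w) μ')
      (impl_rounds C D hW hn hc hcW (F * n + 1) hFn (Nat.lt_succ_self _)
        (by simp) h₁) fun z μ₂ h₂ => Ends.seq (ends_check C D hW hn hr hp hq hpn hqn h₂)
          fun μ₃ h₃ => ends_write hW hn _ h₃.1 h₃.2)
      (fun z => if G.Accepts C p q w z then z else w) fun z μ' h => h)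
      (fun _ _ h => h) le_rfl).weaken (fun _ _ h => h) ?_
  rw [List.length_finRange]
  omega

noncomputable def attemptsProg (c F p q : ℕ) : ℕ → Prog
  | 0 => .skip
  | R + 1 => .seq (attemptProg C D c F p q) (attemptsProg c F p q R)

theorem impl_attempts {p q : ℕ} (hW : 1 < W) (hn : n < W) (hc : c + 1 < W) (hcW : 2 ^ c ≤ W)
    (hF : F < W) (hFn : F * n < W) (hr : r < W) (hp : p < W) (hq : q < W)
    (hpn : p * n < W) (hqn : q * n < W) (R : ℕ) (hb : Base G μ) (hw : HasWord 0 w μ) :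
    Impl W (attemptsProg C D c F p q R) μ (R * (n * 38 + r * ((codeBody C D c).size + 5) + 64 +
      roundCost C D c * (2 * (F * n) + n + n)) + 1) (G.attempts D C p q (F * n) R w) fun w' μ' =>
        Base G μ' ∧ HasWord 0 w' μ' := by
  induction R generalizing w μ with
  | zero => exact (Impl.straight (p := .skip) trivial ⟨hb, hw⟩).weaken (fun _ _ h => h) (by simp [Prog.size])
  | succ R ih =>
    refine (Impl.seq (impl_attempt C D hW hn hc hcW hF hFn hr hp hq hpn hqn hb hw)
      fun w' μ' h => ih h.1 h.2).weaken (fun _ _ h => h) (le_of_eq (by ring))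

/-- The decoder. -/
noncomputable def decoder (c F p q R : ℕ) : Prog :=
  .seq (.const 2 1) (attemptsProg C D c F p q R)

/-- All entries of the input are below `W`, so their reduction modulo `W` changes nothing. -/
theorem base_inputMemory {x : Fin n → ZMod 2} (hW : 1 < W) (hn : n < W) (hr : r < W) :
    Base G ((inputMemory W G x).setReg 2 1) ∧ HasWord 0 x ((inputMemory W G x).setReg 2 1) := by
  refine ⟨⟨by simp, ?_, ?_, fun u j => ?_, fun v j => ?_⟩, fun v => ?_⟩
  · simp [inputMemory, Nat.mod_eq_of_lt hn]
  · simp [inputMemory, Nat.mod_eq_of_lt hr]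
  · have h : (G.nbrOfRight u j : ℕ) < W := (G.nbrOfRight u j).2.trans hn
    simp [inputMemory, Nat.mod_eq_of_lt h]
  · have h : (G.nbrOfLeft v j : ℕ) < W := (G.nbrOfLeft v j).2.trans hr
    have e1 : ¬ (1 + d + (j : ℕ) - 1 < d) := by omega
    have e2 : 1 + d + (j : ℕ) - 1 - d = j := by omega
    simp [inputMemory, e1, e2, Nat.mod_eq_of_lt h]
  · have h : (x v).val < W := (ZMod.val_lt (x v)).trans_le hW
    simp [inputMemory, Nat.mod_eq_of_lt h]

theorem impl_decoder {p q : ℕ} {x : Fin n → ZMod 2} (hW : 1 < W) (hn : n < W) (hc : c + 1 < W)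
    (hcW : 2 ^ c ≤ W) (hF : F < W) (hFn : F * n < W) (hr : r < W) (hp : p < W) (hq : q < W)
    (hpn : p * n < W) (hqn : q * n < W) (R : ℕ) :
    Impl W (decoder C D c F p q R) (inputMemory W G x)
      (R * (n * 38 + r * ((codeBody C D c).size + 5) + 64 +
      roundCost C D c * (2 * (F * n) + n + n)) + 3) (G.attempts D C p q (F * n) R x) fun w' =>
        HasWord 0 w' := by
  refine (Ends.seq (k₁ := 1) (Q := fun μ' => Base G μ' ∧ HasWord 0 x μ')
    (Ends.straight (p := .const 2 1) trivial ?_) fun μ' h =>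
      impl_attempts C D hW hn hc hcW hF hFn hr hp hq hpn hqn R h.1 h.2).weaken
        (fun _ _ h => h.2) (by omega)
  rw [Prog.exec, Nat.mod_eq_of_lt hW]
  exact base_inputMemory hW hn hr

end RandRAM

/-! ### The choice of the constants -/

open RegularBipartiteGraph RandRAM in
/-- A decoder all of whose parameters are fixed halts in linear time on words of logarithmic length,
and its failure probability is that of the attempts. -/
theorem exists_decoder {c d : ℕ} (C : Submodule (ZMod 2) (Fin d → ZMod 2))
    (D : (Fin d → ZMod 2) → Option (Fin d)) (hd : 0 < d) (F p q R : ℕ) :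
    ∃ (P : Prog) (b K : ℕ), ∀ (n r : ℕ) (G : RegularBipartiteGraph c d n r), 0 < n →
      ∀ x : Fin n → ZMod 2,
        (∀ ω : Fin (K * n) → Bool, (run (wordModulus b n) ω (start P b G x)).Halted) ∧
        ∀ y : Fin n → ZMod 2,
          1 - ((G.attempts D C p q (F * n) R x).expect fun z => if z = y then 0 else 1) ≤
            coinProb fun ω : Fin (K * n) → Bool =>
              (run (wordModulus b n) ω (start P b G x)).Outputs y := by
  classical
  -- One number dominates all constants of the program; `N₀ * n < W` then rules out every overflow.
  set N₀ := F + p + q + c + 2 ^ c + 2 with hN₀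
  set A := (codeBody C D c).size + 5
  set B := roundCost C D c
  refine ⟨decoder C D c F p q R, N₀ + 1, R * (38 + c * A + 64 + B * (2 * F + 2)) + 3,
    fun n r G hn x => ?_⟩
  -- Loops over the constraints are linear in `n` too, by `r d = c n`.
  have hrn : r ≤ c * n := by
    rw [← card_right_mul G]
    exact Nat.le_mul_of_pos_right r hd
  set W := wordModulus (N₀ + 1) n with hWdef
  have hW : N₀ * n < W := by
    have h1 : N₀ < 2 ^ N₀ := Nat.lt_two_pow_self
    have h2 : n < 2 ^ n.size := Nat.lt_size_self n
    have h3 : 1 ≤ n.size := Nat.size_pos.2 hn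
    calc N₀ * n < 2 ^ N₀ * 2 ^ n.size := Nat.mul_lt_mul'' h1 h2
      _ = 2 ^ (N₀ + n.size) := (pow_add _ _ _).symm
      _ ≤ W := by
        rw [hWdef, wordModulus]
        refine Nat.pow_le_pow_right (by norm_num) ?_
        nlinarith
  have hexp : N₀ * n = F * n + p * n + q * n + c * n + 2 ^ c * n + 2 * n := by
    rw [hN₀]
    ring
  have hle : ∀ a, a ≤ a * n := fun a => Nat.le_mul_of_pos_right a hn
  have hF := hle F
  have hp := hle p
  have hq := hle q
  have hc := hle c
  have hc2 := hle (2 ^ c)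
  have himpl := impl_decoder (W := W) C D (G := G) (x := x) (p := p) (q := q) (F := F)
    (by omega) (by omega) (by omega) (by omega) (by omega) (by omega) (by omega) (by omega)
    (by omega) (by omega) (by omega) R
  have hK : R * (n * 38 + r * A + 64 + B * (2 * (F * n) + n + n)) + 3 ≤
      (R * (38 + c * A + 64 + B * (2 * F + 2)) + 3) * n := by
    have h1 : n * 38 + r * A + 64 + B * (2 * (F * n) + n + n) ≤
        (38 + c * A + 64 + B * (2 * F + 2)) * n := by
      have := Nat.mul_le_mul_right A hrn
      nlinarith
    calc _ ≤ R * ((38 + c * A + 64 + B * (2 * F + 2)) * n) + 3 * n :=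
          Nat.add_le_add (Nat.mul_le_mul_left R h1) (by omega)
      _ = _ := by ring
  set T := (R * (38 + c * A + 64 + B * (2 * F + 2)) + 3) * n
  replace himpl := himpl.weaken (fun _ _ h => h) hK
  refine ⟨fun ω => ?_, fun y => ?_⟩
  -- The mean of the indicator of not having halted is at most `0`; being nonnegative, it vanishes
  -- for every sequence of coins.
  · have habs : Absorbing W fun s => if s.Halted then (0 : ℝ) else 1 := by
      refine absorbing_indicator _ fun s b hs => ?_
      rcases s with ⟨_ | ⟨p, K⟩, μ⟩
      · exact rfl
      · exact absurd hs (by simp [Config.Halted])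
    have h := himpl _ habs [] 0 (fun _ => 0) fun a μ' _ => by
      simp [avg, Config.Halted]
    rw [CoinTree.expect_const, Nat.zero_add, avg_eq_sum] at h
    have h0 : ∑ ω : Fin T → Bool, (if (run W ω (start (decoder C D c F p q R) (N₀ + 1) G x)).Halted
        then (0 : ℝ) else 1) ≤ 0 := by
      have hpos : (0 : ℝ) < 2 ^ T := by positivity
      have := (div_le_iff₀ hpos).1 h
      rwa [zero_mul] at this
    have hall := (Finset.sum_eq_zero_iff_of_nonneg (fun ω _ => by split_ifs <;> norm_num)).1
      (le_antisymm h0 (Finset.sum_nonneg fun ω _ => by split_ifs <;> norm_num)) ω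
      (Finset.mem_univ _)
    by_contra hcon
    rw [if_neg hcon] at hall
    exact one_ne_zero hall
  · have habs : Absorbing W fun s => if s.Outputs y then (0 : ℝ) else 1 := by
      refine absorbing_indicator _ fun s b hs => ?_
      rcases s with ⟨_ | ⟨p, K⟩, μ⟩
      · exact hs
      · exact absurd hs.1 (by simp [Config.Halted])
    have h := himpl _ habs [] 0 (fun z => if z = y then 0 else 1) fun a μ' ha => by
      rw [avg]
      by_cases hay : a = y
      · have hout : Config.Outputs ⟨[], μ'⟩ y := ⟨rfl, fun v => by rw [← hay]; exact ha v⟩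
        rw [if_pos hout, if_pos hay]
      · rw [if_neg hay]
        split_ifs <;> norm_num
    rw [Nat.zero_add] at h
    rw [coinProb_eq_avg W T (fun s => s.Outputs y)]
    exact sub_le_sub_left h 1

/-- The failure probability of one attempt is exponentially small in the number of errors. -/
theorem mul_add_pow_le_inv_pow {lam Lam th Γ : ℝ} (hlam : 1 ≤ lam) (hLam : 1 < Lam) (hth : 0 ≤ th)
    (hth1 : th ≤ 1) {F m n k : ℕ} (hF : th ^ F ≤ lam⁻¹ * Lam⁻¹ ^ 2 * min 1 (Lam - 1))
    (hΓ0 : 0 ≤ Γ) (hΓ : lam ^ m * Γ = Lam⁻¹ ^ (2 * m)) (hk : k ≤ m) (hmn : m ≤ n) (hm : 1 ≤ m) :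
    lam ^ k * (Γ + th ^ (F * n)) ≤ Lam⁻¹ ^ m := by
  have hL0 : 0 < Lam⁻¹ := by positivity
  have hL1 : Lam⁻¹ ≤ 1 := inv_le_one_of_one_le₀ hLam.le
  have hmin0 : 0 ≤ min 1 (Lam - 1) := le_min zero_le_one (by linarith)
  -- `F` makes the fuel term at most `Lam - 1` times the other term `Lam⁻¹ ^ (2 * m)`. Their sum is
  -- at most `Lam * Lam⁻¹ ^ (2 * m)`, which `m ≥ 1` reduces to `Lam⁻¹ ^ m`.
  have h1 : lam ^ m * th ^ (F * n) ≤ Lam⁻¹ ^ (2 * m) * (Lam - 1) :=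
    calc lam ^ m * th ^ (F * n) ≤ lam ^ m * th ^ (F * m) := by
          gcongr lam ^ m * ?_
          exact pow_le_pow_of_le_one hth hth1 (Nat.mul_le_mul_left F hmn)
      _ = lam ^ m * (th ^ F) ^ m := by rw [pow_mul]
      _ ≤ lam ^ m * (lam⁻¹ * Lam⁻¹ ^ 2 * min 1 (Lam - 1)) ^ m := by gcongr
      _ = (lam * lam⁻¹) ^ m * Lam⁻¹ ^ (2 * m) * min 1 (Lam - 1) ^ m := by
          rw [pow_mul, mul_pow, mul_pow, mul_pow]
          ring
      _ = Lam⁻¹ ^ (2 * m) * min 1 (Lam - 1) ^ m := by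
          rw [mul_inv_cancel₀ (by positivity), one_pow, one_mul]
      _ ≤ Lam⁻¹ ^ (2 * m) * min 1 (Lam - 1) := by
          gcongr
          exact pow_le_of_le_one hmin0 (min_le_left _ _) (by omega)
      _ ≤ Lam⁻¹ ^ (2 * m) * (Lam - 1) := by
          gcongr
          exact min_le_right _ _
  calc lam ^ k * (Γ + th ^ (F * n)) ≤ lam ^ m * (Γ + th ^ (F * n)) := by gcongr
    _ ≤ Lam⁻¹ ^ (2 * m) + Lam⁻¹ ^ (2 * m) * (Lam - 1) := by
        rw [mul_add, hΓ]
        gcongr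
    _ = Lam⁻¹ ^ m * (Lam⁻¹ ^ m * Lam) := by ring
    _ ≤ Lam⁻¹ ^ m * 1 := by
        gcongr
        calc Lam⁻¹ ^ m * Lam ≤ Lam⁻¹ * Lam := by
              gcongr
              exact pow_le_of_le_one hL0.le hL1 (by omega)
          _ = 1 := inv_mul_cancel₀ (by positivity)
    _ = _ := mul_one _

theorem theorem1p5 (c d₀ : ℕ) (δ : ℝ) (hc : 0 < c) (hδ₀ : 0 < δ) (hδ₁ : δ ≤ 1)
    (hδd₀ : 3 < δ * d₀) :
    -- the rate `κ` of the success probability depends on `c`, `δ`, `d₀` only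
    ∃ κ : ℝ, 0 < κ ∧
      ∀ (d k₀ : ℕ) (α : ℝ) (C₀ : Submodule (ZMod 2) (Fin d → ZMod 2)),
        0 < d → 0 < k₀ → 0 < α → α ≤ 1 → IsLinearCode d k₀ d₀ C₀ →
        -- one program `P`, one word length factor `b` and one time constant `K` for all `n` and `G`
        ∃ (P : RandRAM.Prog) (b K : ℕ),
          ∀ (n r : ℕ) (G : RegularBipartiteGraph c d n r), 0 < n → G.IsExpander α δ →
            ∀ x : Fin n → ZMod 2,
              -- the machine halts within `K * n` steps, whatever the coins are
              (∀ ω : Fin (K * n) → Bool,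
                (RandRAM.run (RandRAM.wordModulus b n) ω (RandRAM.start P b G x)).Halted) ∧
              -- up to `α * n` errors are corrected with high probability
              ∀ y ∈ G.tannerCode C₀, (hammingDist x y : ℝ) ≤ α * n →
                1 - Real.exp (-(κ * n)) ≤
                  RandRAM.coinProb fun ω : Fin (K * n) → Bool =>
                    (RandRAM.run (RandRAM.wordModulus b n) ω
                      (RandRAM.start P b G x)).Outputs y := by
  classical
  -- The largest radius with `t δ ≤ 1`: then `3 t δ ≤ 3 < δ d₀`, while `(t + 1) δ > 1` leaves a
  -- positive margin.
  set t : ℕ := ⌊1 / δ⌋₊ with ht_def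
  have ht1 : 1 ≤ t := Nat.le_floor (by rw [Nat.cast_one, le_div_iff₀ hδ₀]; linarith)
  have htδ : (t : ℝ) * δ ≤ 1 := by
    rw [← le_div_iff₀ hδ₀]
    exact Nat.floor_le (by positivity)
  have htδ' : 1 < δ * ((t : ℝ) + 1) := by
    have := Nat.lt_floor_add_one (1 / δ)
    rwa [div_lt_iff₀ hδ₀, mul_comm] at this
  have ht3 : 3 * t < d₀ := by
    have : (3 * t : ℝ) < d₀ := by
      by_contra hcon
      push Not at hcon
      nlinarith
    exact_mod_cast this
  have ht0 : (0 : ℝ) < t := by exact_mod_cast ht1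
  -- A slightly smaller expansion factor keeps the margin positive and admits error sets larger than
  -- `⌊α n⌋` by the factor `δ / δ'`.
  obtain ⟨δ', hδ'1, hδ'δ⟩ : ∃ δ' : ℝ, 1 / ((t : ℝ) + 1) < δ' ∧ δ' < δ :=
    exists_between ((div_lt_iff₀ (by positivity)).2 htδ')
  have hδ'0 : 0 < δ' := lt_trans (by positivity) hδ'1
  rw [div_lt_iff₀ (by positivity)] at hδ'1
  -- This value turns `vote_margin` into the margin `2 h c |E|` that a round requires.
  set h : ℝ := (((t : ℝ) + 1) * δ' - 1) / (2 * t) with hh_def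
  have hh : 0 < h := div_pos (by linarith) (by positivity)
  have hht : t * (2 * h) = ((t : ℝ) + 1) * δ' - 1 := by
    rw [hh_def]
    field_simp
  set ν := δ / δ' with hν
  have hν1 : 1 < ν := (one_lt_div hδ'0).2 hδ'δ
  have hlam0 : 0 < 1 + h := by linarith
  -- Outgrowing the range of expansion contributes `(1 + h) ^ (-(ν - 1) m) = Lam⁻¹ ^ (2 m)`; the
  -- halved exponent leaves room for the fuel term.
  set Lam : ℝ := (1 + h) ^ ((ν - 1) / 2) with hLam_def
  have hLam : 1 < Lam := Real.one_lt_rpow (by linarith) (by linarith)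
  set th : ℝ := Real.exp (-(h ^ 2 / 2 ^ c)) with hth_def
  have hth0 : 0 < th := Real.exp_pos _
  have hth1 : th < 1 := Real.exp_lt_one_iff.2 (by
    have : 0 < h ^ 2 / 2 ^ c := by positivity
    linarith)
  obtain ⟨F, hF⟩ := exists_pow_lt_of_lt_one
    (show 0 < (1 + h)⁻¹ * Lam⁻¹ ^ 2 * min 1 (Lam - 1) by
      have : 0 < min 1 (Lam - 1) := lt_min one_pos (by linarith)
      positivity) hth1
  -- Nothing chosen so far involves `α`, `d` or the code, so `κ` can be fixed here.
  refine ⟨Real.log Lam, Real.log_pos hLam, fun d k₀ α C₀ hd _ hα hα1 hC₀ => ?_⟩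
  have hdist : ∀ a ∈ C₀, ∀ b ∈ C₀, a ≠ b → d₀ ≤ hammingDist a b := fun a ha b hb hab =>
    hC₀.dist.2 ⟨a, ha, b, hb, hab, rfl⟩
  obtain ⟨D, hD⟩ := exists_isBoundedDecoder (t := t) hdist (by omega)
  -- `q` is the number of repetitions and also the denominator of the threshold. Since `α q ≥ 2`,
  -- rounding up gives `α ≤ p / q ≤ 3 α / 2`.
  set q : ℕ := ⌈2 / α⌉₊ with hq_def
  set p : ℕ := ⌈α * q⌉₊ with hp_def
  have hαq : 2 ≤ α * q := by
    have := Nat.le_ceil (2 / α)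
    rwa [div_le_iff₀ hα, mul_comm] at this
  have hp1 : α * q ≤ p := Nat.le_ceil _
  have hp2 : (p : ℝ) ≤ 3 / 2 * (α * q) := by
    have := (Nat.ceil_lt_add_one (show 0 ≤ α * q by positivity)).le
    change (p : ℝ) ≤ _ at this
    linarith
  have hq0 : (0 : ℝ) < q := by
    by_contra hcon
    nlinarith
  obtain ⟨P, b, K, hP⟩ := exists_decoder (c := c) C₀ D hd F p q q
  refine ⟨P, b, K, fun n r G hn hG x => ⟨(hP n r G hn x).1, fun y hy hxy => ?_⟩⟩
  refine le_trans (sub_le_sub_left ?_ 1) ((hP n r G hn x).2 y)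
  have hn' : (0 : ℝ) < n := by exact_mod_cast hn
  set m := ⌊α * n⌋₊ with hm_def
  have hxm : hammingDist x y ≤ m := Nat.le_floor hxy
  -- For `m = 0` the received word is already the codeword, which the attempts leave unchanged.
  rcases Nat.eq_zero_or_pos m with hm0 | hm
  · have hxy' : x = y := hammingDist_eq_zero.1 (by omega)
    rw [hxy', G.attempts_of_mem_tannerCode hD (by omega) hy, CoinTree.expect, if_pos rfl]
    positivity
  have hmα : α * n < m + 1 := Nat.lt_floor_add_one _
  have hm1 : (1 : ℝ) ≤ m := by exact_mod_cast hm
  have hmn : m ≤ n := by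
    have h1 : (m : ℝ) ≤ α * n := Nat.floor_le (by positivity)
    have h2 : (m : ℝ) ≤ n := h1.trans (mul_le_of_le_one_left hn'.le hα1)
    exact_mod_cast h2
  have hacc : ∀ z, G.Accepts C₀ p q x z → z = y := by
    rintro z ⟨hz, hzx⟩
    have h1 : (q : ℝ) * hammingDist x z ≤ p * n := by exact_mod_cast hzx
    -- Here `3 / 2 * α n < 3 / 2 * (m + 1) ≤ 2 m + 1` as `m ≥ 1`. So `z` is within `2 m` of `x` and
    -- within `3 m` of `y`.
    have h2 : (hammingDist x z : ℝ) < 2 * m + 1 := by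
      have h3 : (q : ℝ) * hammingDist x z ≤ q * (3 / 2 * (α * n)) :=
        h1.trans ((mul_le_mul_of_nonneg_right hp2 hn'.le).trans_eq (by ring))
      have h4 := le_of_mul_le_mul_left h3 hq0
      linarith
    have h3 : hammingDist x z < 2 * m + 1 := by exact_mod_cast h2
    have h4 := hammingDist_triangle z x y
    rw [hammingDist_comm z x] at h4
    exact hG.eq_of_hammingDist_le G hα.le hc hm hdist hδd₀ hy hz (by omega)
  have hyx : G.Accepts C₀ p q x y := by
    refine ⟨hy, ?_⟩
    have : (q : ℝ) * hammingDist x y ≤ p * n :=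
      calc (q : ℝ) * hammingDist x y ≤ q * (α * n) := by gcongr
        _ = α * q * n := by ring
        _ ≤ p * n := by gcongr
    exact_mod_cast this
  -- `β` is the size up to which sets expand by `δ'`, and `Γ` is the power that makes the bound
  -- trivial beyond it.
  have hrounds := G.expect_rounds_le hD (by omega) hy hc hh (β := ν * m)
    (Γ := (1 + h) ^ (-(ν * m))) (by positivity) ?_ ?_ (F * n + 1) (F * n) (Nat.lt_succ_self _)
    (List.finRange n) x (G.covers_finRange x)
  · have hround := hrounds.trans (mul_add_pow_le_inv_pow (by linarith) hLam hth0.le hth1.le hF.le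
      (by positivity) (m := m) ?_ (by
        rw [RegularBipartiteGraph.card_errors]
        exact hxm) hmn hm)
    · refine (G.expect_attempts_le hD (by omega) hy (by positivity) hacc hyx hround q).trans ?_
      -- From `α q ≥ 2` and `2 m ≥ m + 1 > α n`; the repetitions thus remove `α` from the exponent.
      have hmq : n ≤ m * q := by
        have : (n : ℝ) ≤ m * q := by nlinarith
        exact_mod_cast this
      rw [← pow_mul]
      refine (pow_le_pow_of_le_one (by positivity) (inv_le_one_of_one_le₀ hLam.le) hmq).trans_eq ?_
      rw [← neg_mul, mul_comm, Real.exp_nat_mul, Real.exp_neg, Real.exp_log (by linarith)]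
    · rw [hLam_def, ← Real.rpow_neg hlam0.le, ← Real.rpow_natCast, ← Real.rpow_natCast,
        ← Real.rpow_add hlam0, ← Real.rpow_mul hlam0.le]
      congr 1
      push_cast
      ring
  · intro k hk
    rw [← Real.rpow_natCast, ← Real.rpow_add hlam0]
    exact Real.one_le_rpow (by linarith) (by linarith)
  · intro z hz
    have h1 := G.vote_margin (z := z) hD ht3 hy
    have h2 := hG.card_neighborhood_ge G hα.le hδ'0 hδ'δ.le hz
    refine le_of_mul_le_mul_left (le_trans ?_ h1) ht0
    calc (t : ℝ) * (2 * h * c * (RegularBipartiteGraph.errors y z).card)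
        = t * (2 * h) * (c * (RegularBipartiteGraph.errors y z).card) := by ring
      _ = (t + 1) * (δ' * c * (RegularBipartiteGraph.errors y z).card) -
          c * (RegularBipartiteGraph.errors y z).card := by rw [hht]; ring
      _ ≤ _ := by gcongr
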